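/- Let $\xi_0\in(0,1)$ be rational, $q\in C^1[0,1]$ real-valued with $\int_0^1q(x)\,dx=0$, $h\in\mathbb R$ and $\gamma_0\in\mathbb R\setminus\{0\}$, and let $L=L(q,h,\gamma_0)$ be the boundary value problem $$-y''+q(x)y=\lambda y\ \ (0<x<1),\qquad U(y):=y'(0)+hy(0)-\gamma_0y(\xi_0)=0,\qquad V(y):=y(1)=0 .$$ Let $C(\cdot,\lambda)$, $S(\cdot,\lambda)$ be the solutions of the equation with $C(0)=1$, $C'(0)=0$, $S(0)=0$, $S'(0)=1$. The eigenvalues $\lambda_0,\lambda_1,\dots\in\mathbb C$ are the zeros of $\Delta(\lambda)=U(C)V(S)-U(S)V(C)$, listed by non-decreasing modulus and repeated according to their multiplicity as zeros of $\Delta$. Let $X_n$ be the set of nodal points of $\lambda_n$, i.e. the zeros in $(0,1)$ of the corresponding eigenfunction, numbered in increasing order as $x_n^0<x_n^1<\cdots$. A nodal set $X_0$ of $L$ is a family of subsets of the $X_n$, one for each $n$ (so each point carries the number $n$ of its eigenvalue); it is called dense if for every $x\in(0,1)$ there are points $x_n^{j_n}\in X_0$, one for each large $n$, with $x_n^{j_n}\to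 x$ as $n\to\infty$. The family of all nodal points is dense in this sense, and the following holds. (i) Uniqueness. Let $\widetilde L=L(\widetilde q,\widetilde h,\widetilde\gamma_0)$ be a second problem satisfying the same assumptions, with the same $\xi_0$, and let $X_0$, $\widetilde X_0$ be dense nodal sets of $L$, $\widetilde L$. If $X_0=\widetilde X_0$ (for every $n$ the same points), then $q=\widetilde q$ a.e. in $(0,1)$, $h=\widetilde h$ and $\gamma_0=\widetilde\gamma_0$. (ii) Reconstruction. Let $X_0$ be a dense nodal set of $L$ and $\xi_0=p_0/r_0$ with integers $p_0$ and $r_0\ge1$. Then for every $x\in[0,1]$ the limit $$\psi(x)=\lim_{m\to\infty}\Bigl(m+\tfrac12\Bigr)^2\pi^2\Bigl(x_m^{j}-\frac{j+\frac12}{m+\frac12}\Bigr),\qquad m=2r_0n,\ n\to\infty,$$ taken along points $x_m^{j}=x_m^{j_m}\in X_0$ with $x_m^{j_m}\to x$, exists and does not depend on the choice of these points; $\psi$ is differentiable on $[0,1]$, and $$q(x)=2\bigl(\psi'(x)+\psi(0)\bigr)\quad(0\le x\le1),\qquad \gamma_0\cos\bigl(\tfrac{\pi}{2}\xi_0\bigr)-h=\psi(0).$$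 -/

import Mathlib

open Set Filter Topology MeasureTheory

/-- The data `(q, h, γ, ξ)` of the problem `-y'' + q y = k y` on `(0,1)`,
`y'(0) + h y(0) = γ y(ξ)`, `y(1) = 0`. -/
structure NonlocalBVP where
  q : ℝ → ℝ
  h : ℝ
  γ : ℝ
  ξ : ℚ

namespace NonlocalBVP

/-- Standing assumptions: `q` is continuously differentiable on `[0,1]` with mean zero, `γ ≠ 0`,
and `ξ` is a rational number in `(0,1)`. -/
structure Admissible (L : NonlocalBVP) : Prop where
  contDiffOn : ContDiffOn ℝ 1 L.q (Icc 0 1)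
  mean_zero : ∫ x in (0 : ℝ)..1, L.q x = 0
  γ_ne_zero : L.γ ≠ 0
  ξ_pos : 0 < L.ξ
  ξ_lt_one : L.ξ < 1

/-- `y` solves `-y'' + q y = k y` on `[0,1]` and `y'` is its derivative there (one-sided at the
end points). -/
def IsSolution (L : NonlocalBVP) (k : ℂ) (y y' : ℝ → ℂ) : Prop :=
  ∀ x ∈ Icc (0 : ℝ) 1,
    HasDerivWithinAt y (y' x) (Icc 0 1) x ∧
    HasDerivWithinAt y' (((L.q x : ℂ) - k) * y x) (Icc 0 1) x

/-- The boundary form `U(y) = y'(0) + h y(0) - γ y(ξ)`. -/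
noncomputable def U (L : NonlocalBVP) (y y' : ℝ → ℂ) : ℂ :=
  y' 0 + L.h * y 0 - L.γ * y (L.ξ : ℝ)

/-- The boundary form `V(y) = y(1)`. -/
def V (_L : NonlocalBVP) (y _y' : ℝ → ℂ) : ℂ := y 1

/-- The solution (together with its derivative) of the differential equation with parameter `k`
and initial values `y(0) = a`, `y'(0) = b`. It exists and is unique on `[0,1]` when `q` is
continuous there. -/
noncomputable def cauchySol (L : NonlocalBVP) (a b k : ℂ) : (ℝ → ℂ) × (ℝ → ℂ) :=
  Classical.epsilon fun Y : (ℝ → ℂ) × (ℝ → ℂ) =>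
    L.IsSolution k Y.1 Y.2 ∧ Y.1 0 = a ∧ Y.2 0 = b

/-- The characteristic function `Δ = U(C) V(S) - U(S) V(C)`, where `C`, `S` are the solutions
with `C(0) = 1`, `C'(0) = 0`, `S(0) = 0`, `S'(0) = 1`. -/
noncomputable def charFun (L : NonlocalBVP) (k : ℂ) : ℂ :=
  let C := L.cauchySol 1 0 k
  let S := L.cauchySol 0 1 k
  L.U C.1 C.2 * L.V S.1 S.2 - L.U S.1 S.2 * L.V C.1 C.2

/-- `lam 0, lam 1, …` lists the eigenvalues, each repeated according to its multiplicity as a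
zero of the characteristic function, by non-decreasing modulus. -/
def IsEigenvalueSeq (L : NonlocalBVP) (lam : ℕ → ℂ) : Prop :=
  (Monotone fun n => ‖lam n‖) ∧
  ∀ μ : ℂ, {n | lam n = μ}.encard = analyticOrderAt L.charFun μ

/-- `y` (with derivative `y'`) is an eigenfunction for `k`: a solution, not identically zero on
`[0,1]`, that satisfies both boundary conditions. -/
def IsEigenfunction (L : NonlocalBVP) (k : ℂ) (y y' : ℝ → ℂ) : Prop :=
  L.IsSolution k y y' ∧ (∃ x ∈ Icc (0 : ℝ) 1, y x ≠ 0) ∧ L.U y y' = 0 ∧ L.V y y' = 0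

/-- The nodal points of the eigenvalue `k`: the zeros in `(0,1)` of its eigenfunction (which is
unique up to a constant factor). -/
def nodes (L : NonlocalBVP) (k : ℂ) : Set ℝ :=
  {x | x ∈ Ioo (0 : ℝ) 1 ∧ ∃ y y' : ℝ → ℂ, L.IsEigenfunction k y y' ∧ y x = 0}

/-- The position `j = 0, 1, 2, …` of a nodal point `x` among the nodal points of `k` in increasing
order: the number of nodal points to the left of `x`. -/
noncomputable def nodeIndex (L : NonlocalBVP) (k : ℂ) (x : ℝ) : ℕ :=
  (L.nodes k ∩ Iio x).ncard

/-- `X₀ n` is, for each `n`, a set of nodal points of the `n`-th eigenvalue, and every `x ∈ (0,1)`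
is the limit of a sequence of points `t n ∈ X₀ n` (`n` large). -/
def IsDenseNodalSubset (L : NonlocalBVP) (lam : ℕ → ℂ) (X₀ : ℕ → Set ℝ) : Prop :=
  (∀ n, X₀ n ⊆ L.nodes (lam n)) ∧
  ∀ x ∈ Ioo (0 : ℝ) 1, ∃ t : ℕ → ℝ, (∀ᶠ n in atTop, t n ∈ X₀ n) ∧ Tendsto t atTop (𝓝 x)

end NonlocalBVP

/-! Measure from the right end: with s = 1 - x, let z be the solution with z = 0 and z' = 1 at s =
0. Eigenfunctions are multiples of z, and Δ is the form U evaluated on z, so Δ(ρ²) = -cos ρ +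
O(e^{|Im ρ|}/|ρ|). Comparison with cos ρ on the circles |λ| = (Nπ)² (Rouché) shows that for large n
exactly one eigenvalue, `lam n`, lies between consecutive circles; conjugation symmetry makes it
real, and it equals ρ_n² with ρ_n close to ν_n = (n + 1/2)π
(`IsEigenvalueSeq.eventually_exists_sqrt`).

In Prüfer form z' + iρz = exp(a + iθ), the phase satisfies θ(s) = ρs + P(1 - s)/(2ρ) + O(ρ⁻²), where
P(x) is the integral of q over [0, x] (`Prufer.abs_angle_sub_le`). The boundary condition becomes an
equation for θ(1) and yields ν_n(ρ_n - ν_n) = A_n + o(1) with A_n = γ cos(ν_n ξ) - h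
(`tendsto_nu_mul_sub`). A node x of index j is a solution of θ(1 - x) = (n - j)π, hence, uniformly
in the node, ν_n² (x - (j + 1/2)/(n + 1/2)) = A_n (1 - x) + P(x)/2 + o(1)
(`exists_node_asymptotics`).

If ξ = p/r, then A_n has period 2r in n (`coefA_add_mul`), so the right side converges along each
residue class. The class of 0 gives ψ(x) = A_0 (1 - x) + P(x)/2, from which q and A_0 are read off.
For uniqueness, the classes of 0 and 1 are compared: this isolates γ, because cos(πξ/2) ≠
cos(3πξ/2); then x → 0 gives h and differentiation gives q. -/

/-! ### Zeros of entire functions: factorisation, argument principle, Rouché -/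

/-- The sequence `lam` lists the zeros of `f` with their multiplicities. -/
def EnumeratesZeros (f : ℂ → ℂ) (lam : ℕ → ℂ) : Prop :=
  ∀ μ : ℂ, {n | lam n = μ}.encard = analyticOrderAt f μ

/-- One root is split off at a time with `dslope`. If the cofactor u did not vanish at the next
root, the order of f there would equal the number of factors already removed, one less than the
count that `hT` allows for. -/
theorem Differentiable.exists_eq_prod_mul {f : ℂ → ℂ} (hf : Differentiable ℂ f) (lam : ℕ → ℂ)
    (T : Finset ℕ)
    (hT : ∀ μ, ((T.filter fun n => lam n = μ).card : ℕ∞) ≤ analyticOrderAt f μ) :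
    ∃ u : ℂ → ℂ, Differentiable ℂ u ∧ ∀ z, f z = (∏ n ∈ T, (z - lam n)) * u z := by
  induction T using Finset.induction_on with
  | empty => exact ⟨f, hf, by simp⟩
  | insert n T hn ih =>
    obtain ⟨u, hu, hfu⟩ := ih fun μ => le_trans
      (Nat.cast_le.2 (Finset.card_le_card
        (Finset.filter_subset_filter _ (Finset.subset_insert _ _)))) (hT μ)
    have hu0 : u (lam n) = 0 := by
      by_contra h0
      have hP : ∀ S : Finset ℕ, analyticOrderAt (fun z => ∏ m ∈ S, (z - lam m)) (lam n)
          = ((S.filter fun m => lam m = lam n).card : ℕ∞) := by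
        intro S
        induction S using Finset.induction_on with
        | empty => simp [analyticOrderAt_eq_zero]
        | insert m S hm ihS =>
          have : (fun z => ∏ k ∈ insert m S, (z - lam k))
              = (fun z => z - lam m) * fun z => ∏ k ∈ S, (z - lam k) := by
            ext z; simp [Finset.prod_insert hm]
          rw [this, analyticOrderAt_mul (by fun_prop)
            (Finset.analyticAt_fun_prod _ fun _ _ => by fun_prop), ihS, Finset.filter_insert]
          split_ifs with h
          · rw [h, Finset.card_insert_of_notMem (by simp [hm])]
            have h1 : analyticOrderAt (fun z : ℂ => z - lam n) (lam n) = 1 :=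
              analyticOrderAt_id_sub_const_self
            rw [h1]; push_cast; ring
          · have h1 : analyticOrderAt (fun z : ℂ => z - lam m) (lam n) = 0 := by
              rw [analyticOrderAt_eq_zero]
              right
              exact sub_ne_zero.2 (Ne.symm h)
            rw [h1, zero_add]
      have h1 : analyticOrderAt f (lam n) = ((T.filter fun m => lam m = lam n).card : ℕ∞) := by
        have : f = (fun z => ∏ m ∈ T, (z - lam m)) * u := by ext z; simp [hfu z]
        rw [this, analyticOrderAt_mul
            (Finset.analyticAt_fun_prod _ fun _ _ => by fun_prop) (hu.analyticAt _), hP T,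
          (hu.analyticAt _).analyticOrderAt_eq_zero.2 h0, add_zero]
      have h2 := hT (lam n)
      rw [h1, Finset.filter_insert, if_pos rfl, Finset.card_insert_of_notMem (by simp [hn])] at h2
      have h3 := Nat.cast_le.1 h2
      omega
    refine ⟨dslope u (lam n), ?_, fun z => ?_⟩
    · rw [← differentiableOn_univ]
      exact (Complex.differentiableOn_dslope univ_mem).2 hu.differentiableOn
    · rw [Finset.prod_insert hn, hfu z]
      have := sub_smul_dslope u (lam n) z
      rw [hu0, sub_zero, smul_eq_mul] at this
      rw [← this]; ring

theorem EnumeratesZeros.apply_eq_zero {f : ℂ → ℂ} {lam : ℕ → ℂ} (h : EnumeratesZeros f lam)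
    (n : ℕ) : f (lam n) = 0 := by
  apply apply_eq_zero_of_analyticOrderAt_ne_zero (𝕜 := ℂ)
  rw [← h (lam n), Ne, Set.encard_eq_zero]
  exact Set.Nonempty.ne_empty ⟨n, rfl⟩

theorem EnumeratesZeros.exists_eq {f : ℂ → ℂ} {lam : ℕ → ℂ} (h : EnumeratesZeros f lam)
    (hf : Differentiable ℂ f) {μ : ℂ} (hμ : f μ = 0) : ∃ n, lam n = μ := by
  have h1 := (hf.analyticAt μ).analyticOrderAt_ne_zero.2 hμ
  rw [← h μ, Set.encard_ne_zero] at h1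
  exact h1

/-- By the identity theorem, zeros cannot accumulate in a closed disc and no zero has infinite
order; the latter bounds the number of repetitions of each value. -/
theorem EnumeratesZeros.finite {f : ℂ → ℂ} {lam : ℕ → ℂ} (h : EnumeratesZeros f lam)
    (hf : Differentiable ℂ f) {z₀ : ℂ} (hz₀ : f z₀ ≠ 0) (R : ℝ) : {n | ‖lam n‖ < R}.Finite := by
  have hfa : AnalyticOnNhd ℂ f univ := fun z _ => hf.analyticAt z
  have hZ : (Metric.closedBall (0 : ℂ) R ∩ f ⁻¹' {0}).Finite := by
    by_contra hinf
    obtain ⟨x, hx, hacc⟩ := Set.Infinite.exists_accPt_of_subset_isCompact hinf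
      (isCompact_closedBall (0 : ℂ) R) inter_subset_left
    have := hfa.eq_of_frequently_eq (g := fun _ => (0 : ℂ)) (fun _ _ => analyticAt_const)
      (z₀ := x) ?_
    · exact hz₀ (congrFun this z₀)
    · rw [accPt_iff_frequently_nhdsNE] at hacc
      exact hacc.mono fun y hy => hy.2
  have hfib : ∀ μ, {n | lam n = μ}.Finite := by
    intro μ
    rw [← Set.encard_ne_top_iff, h μ]
    intro htop
    rw [analyticOrderAt_eq_top] at htop
    have := hfa.eq_of_eventuallyEq (g := fun _ => (0 : ℂ)) (fun _ _ => analyticAt_const)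
      (z₀ := μ) htop
    exact hz₀ (congrFun this z₀)
  refine (hZ.biUnion fun μ _ => hfib μ).subset fun n hn => ?_
  simp only [mem_iUnion, mem_ofPred_eq, exists_prop, exists_eq_right']
  exact ⟨by simpa using le_of_lt hn, h.apply_eq_zero n⟩

/-- The argument principle for an entire function. -/
theorem EnumeratesZeros.circleIntegral_logDeriv {f : ℂ → ℂ} {lam : ℕ → ℂ}
    (h : EnumeratesZeros f lam) (hf : Differentiable ℂ f) {R : ℝ} (hR : 0 < R)
    (h0 : ∀ z ∈ Metric.sphere (0 : ℂ) R, f z ≠ 0) :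
    (∮ z in C(0, R), logDeriv f z) = 2 * Real.pi * Complex.I * {n | ‖lam n‖ < R}.ncard := by
  have hRs : (R : ℂ) ∈ Metric.sphere (0 : ℂ) R := by simp [abs_of_pos hR]
  have hfin := h.finite hf (h0 _ hRs) R
  set T := hfin.toFinset with hTdef
  have hTmem : ∀ n, n ∈ T ↔ ‖lam n‖ < R := fun n => by simp [hTdef]
  have hle : ∀ μ, ((T.filter fun n => lam n = μ).card : ℕ∞) ≤ analyticOrderAt f μ := by
    intro μ
    rw [← h μ, ← Set.encard_coe_eq_coe_finsetCard]
    exact Set.encard_le_encard fun n hn => by simpa using (Finset.mem_filter.1 hn).2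
  obtain ⟨u, hu, hfu⟩ := hf.exists_eq_prod_mul lam T hle
  -- All multiplicity inside the disc is used up by the product: a further zero of u would make the
  -- order of f exceed the number of indices listing that point.
  have hu0 : ∀ z ∈ Metric.closedBall (0 : ℂ) R, u z ≠ 0 := by
    intro z hz huz
    have hfz : f z = 0 := by rw [hfu, huz, mul_zero]
    have hzR : ‖z‖ < R := by
      have h1 : ‖z‖ ≤ R := by simpa using hz
      refine lt_of_le_of_ne h1 fun h2 => h0 z (by simpa using h2) hfz
    -- divide once more and compare multiplicities
    obtain ⟨v, hv, huv⟩ := hu.exists_eq_prod_mul (fun _ => z) {0} (by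
      intro μ
      by_cases hμ : z = μ
      · subst hμ
        have : analyticOrderAt u z ≠ 0 := (hu.analyticAt z).analyticOrderAt_ne_zero.2 huz
        simpa [Finset.filter_singleton] using Order.one_le_iff_ne_zero.2 this
      · simp [Finset.filter_singleton, hμ])
    have hcard : (((T.filter fun n => lam n = z).card + 1 : ℕ) : ℕ∞) ≤ analyticOrderAt f z := by
      rw [natCast_le_analyticOrderAt (hf.analyticAt z)]
      refine ⟨fun w => (∏ n ∈ T.filter (fun n => ¬ lam n = z), (w - lam n)) * v w, ?_, ?_⟩
      · exact (Finset.analyticAt_fun_prod _ fun _ _ => by fun_prop).mul (hv.analyticAt z)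
      · refine Eventually.of_forall fun w => ?_
        rw [hfu w, huv w, ← Finset.prod_filter_mul_prod_filter_not T (fun n => lam n = z)]
        rw [Finset.prod_congr rfl (g := fun _ => w - z)
          (fun n hn => by rw [(Finset.mem_filter.1 hn).2])]
        simp only [Finset.prod_const, Finset.card_singleton, smul_eq_mul]
        ring
    have heq : {n | lam n = z} = ↑(T.filter fun n => lam n = z) := by
      ext n
      simp only [mem_ofPred_eq, Finset.coe_filter, hTmem]
      exact ⟨fun hn => ⟨by rw [hn]; exact hzR, hn⟩, fun hn => hn.2⟩
    rw [← h z, heq, Set.encard_coe_eq_coe_finsetCard] at hcard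
    have := Nat.cast_le.1 hcard
    omega
  have hsub : ∀ z ∈ Metric.sphere (0 : ℂ) R, ∀ n ∈ T, z - lam n ≠ 0 := by
    intro z hz n hn hzn
    have : ‖lam n‖ < R := (hTmem n).1 hn
    rw [← sub_eq_zero.1 hzn] at this
    simp at hz
    linarith
  have hlog : EqOn (logDeriv f) (fun z => (∑ n ∈ T, (z - lam n)⁻¹) + logDeriv u z)
      (Metric.sphere 0 R) := by
    intro z hz
    have hfe : f = fun z => (∏ n ∈ T, (z - lam n)) * u z := funext hfu
    have hd : ∀ n ∈ T, DifferentiableAt ℂ (fun w : ℂ => w - lam n) z := fun n _ => by fun_prop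
    have hp : DifferentiableAt ℂ (fun w => ∏ n ∈ T, (w - lam n)) z := by
      fun_prop
    rw [hfe, logDeriv_mul z (Finset.prod_ne_zero_iff.2 (hsub z hz))
      (hu0 z (Metric.sphere_subset_closedBall hz)) hp (hu z),
      logDeriv_prod (f := fun n (w : ℂ) => w - lam n) (hsub z hz) hd]
    congr 1
    refine Finset.sum_congr rfl fun n _ => ?_
    simp [logDeriv_apply]
  have hint : ∀ n ∈ T, CircleIntegrable (fun z => (z - lam n)⁻¹) 0 R := by
    intro n hn
    apply ContinuousOn.circleIntegrable hR.le
    exact ContinuousOn.inv₀ (by fun_prop) fun z hz => hsub z hz n hn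
  have hdu : Differentiable ℂ (deriv u) := by
    rw [← differentiableOn_univ]
    exact hu.differentiableOn.deriv isOpen_univ
  have hcu : ContinuousOn (logDeriv u) (Metric.closedBall 0 R) := by
    exact ContinuousOn.div hdu.continuous.continuousOn hu.continuous.continuousOn hu0
  have hu_int : (∮ z in C(0, R), logDeriv u z) = 0 := by
    refine Complex.circleIntegral_eq_zero_of_differentiable_on_off_countable hR.le
      countable_empty hcu fun z hz => ?_
    exact (hdu z).div (hu z) (hu0 z (Metric.ball_subset_closedBall hz.1))
  rw [circleIntegral.integral_congr hR.le hlog, circleIntegral.integral_add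
    (CircleIntegrable.fun_sum T hint)
    ((hcu.mono Metric.sphere_subset_closedBall).circleIntegrable hR.le), hu_int,
    circleIntegral.integral_fun_sum hint, add_zero]
  rw [Finset.sum_congr rfl (fun n hn => circleIntegral.integral_sub_inv_of_mem_ball
    (by simpa using (hTmem n).1 hn)), Finset.sum_const, nsmul_eq_mul,
    Set.ncard_eq_toFinset_card _ hfin]
  ring

/-- Rouché's theorem for entire functions and discs about the origin. -/
theorem EnumeratesZeros.ncard_eq {f g : ℂ → ℂ} {lam lam' : ℕ → ℂ}
    (h : EnumeratesZeros f lam) (h' : EnumeratesZeros g lam') (hf : Differentiable ℂ f)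
    (hg : Differentiable ℂ g) {R : ℝ} (hR : 0 < R)
    (hlt : ∀ z ∈ Metric.sphere (0 : ℂ) R, ‖f z - g z‖ < ‖g z‖) :
    {n | ‖lam n‖ < R}.ncard = {n | ‖lam' n‖ < R}.ncard := by
  have hg0 : ∀ z ∈ Metric.sphere (0 : ℂ) R, g z ≠ 0 := fun z hz h0 => by
    have := hlt z hz
    rw [h0, norm_zero] at this
    exact absurd this (not_lt.2 (norm_nonneg _))
  have hf0 : ∀ z ∈ Metric.sphere (0 : ℂ) R, f z ≠ 0 := fun z hz h0 => by
    have := hlt z hz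
    rw [h0, zero_sub, norm_neg] at this
    exact lt_irrefl _ this
  have hcont : ∀ {k : ℂ → ℂ}, Differentiable ℂ k → (∀ z ∈ Metric.sphere (0 : ℂ) R, k z ≠ 0) →
      CircleIntegrable (logDeriv k) 0 R := by
    intro k hk hk0
    have hdk : Differentiable ℂ (deriv k) := by
      rw [← differentiableOn_univ]
      exact hk.differentiableOn.deriv isOpen_univ
    exact (ContinuousOn.div hdk.continuous.continuousOn hk.continuous.continuousOn
      hk0).circleIntegrable hR.le
  -- On the circle f/g stays within distance 1 of 1, so the principal logarithm of f/g is a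
  -- single-valued primitive of the difference of the logarithmic derivatives.
  have hzero : (∮ z in C(0, R), (logDeriv f z - logDeriv g z)) = 0 := by
    refine circleIntegral.integral_eq_zero_of_hasDerivWithinAt
      (f := fun z => Complex.log (f z / g z)) hR.le fun z hz => ?_
    have hs : f z / g z ∈ Complex.slitPlane := by
      have : f z / g z = 1 + (f z - g z) / g z := by
        field_simp [hg0 z hz]; ring
      rw [this]
      apply Complex.mem_slitPlane_of_norm_lt_one
      rw [norm_div, div_lt_one (norm_pos_iff.2 (hg0 z hz))]
      exact hlt z hz
    have hd := ((hf z).hasDerivAt.div (hg z).hasDerivAt (hg0 z hz)).clog hs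
    refine (hd.congr_deriv ?_).hasDerivWithinAt
    have h1 := hg0 z hz
    have h2 := hf0 z hz
    simp only [logDeriv_apply, Pi.div_apply]
    field_simp
  rw [circleIntegral.integral_sub (hcont hf hf0) (hcont hg hg0),
    h.circleIntegral_logDeriv hf hR hf0, h'.circleIntegral_logDeriv hg hR hg0, sub_eq_zero] at hzero
  have hpi : (2 * Real.pi * Complex.I : ℂ) ≠ 0 := Complex.two_pi_I_ne_zero
  exact_mod_cast mul_left_cancel₀ hpi hzero

/-! ### Existence for second-order linear equations -/

/-- Each integration against the weight exp(κw) gains a factor 1/κ; two of them turn the Picard map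
into a contraction on all of [0,1] at once. -/
theorem norm_integral_le_of_norm_le_exp {H : ℝ → ℂ} {M κ u : ℝ} (hκ : 0 < κ) (hM : 0 ≤ M)
    (hu : 0 ≤ u) (hH : ∀ w, 0 ≤ w → ‖H w‖ ≤ M * Real.exp (κ * w)) :
    ‖∫ w in (0 : ℝ)..u, H w‖ ≤ M / κ * Real.exp (κ * u) := by
  have h1 : ‖∫ w in (0 : ℝ)..u, H w‖ ≤ ∫ w in (0 : ℝ)..u, M * Real.exp (κ * w) := by
    apply intervalIntegral.norm_integral_le_of_norm_le hu
    · exact ae_of_all _ fun w hw => hH w hw.1.le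
    · exact (by fun_prop : Continuous fun w => M * Real.exp (κ * w)).intervalIntegrable _ _
  have h2 : (∫ w in (0 : ℝ)..u, M * Real.exp (κ * w))
      = M / κ * Real.exp (κ * u) - M / κ * Real.exp (κ * 0) := by
    apply intervalIntegral.integral_eq_sub_of_hasDerivAt (f := fun w => M / κ * Real.exp (κ * w))
    · intro w _
      have := (((hasDerivAt_id w).const_mul κ).exp).const_mul (M / κ)
      refine this.congr_deriv ?_
      simp only [id]
      field_simp
    · exact (by fun_prop : Continuous fun w => M * Real.exp (κ * w)).intervalIntegrable _ _
  have h3 : 0 ≤ M / κ * Real.exp (κ * 0) := by positivity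
  linarith

/-- Global existence for the linear equation `y'' = p y` on `[0,1]`. -/
theorem exists_solution_second_order {p : ℝ → ℂ} (hp : ContinuousOn p (Icc 0 1)) (a b : ℂ) :
    ∃ y y' : ℝ → ℂ, (∀ x ∈ Icc (0 : ℝ) 1, HasDerivWithinAt y (y' x) (Icc 0 1) x ∧
      HasDerivWithinAt y' (p x * y x) (Icc 0 1) x) ∧ y 0 = a ∧ y' 0 = b := by
  -- Constant extension beyond [0,1], so that the primitives below have two-sided derivatives
  -- everywhere.
  set pe : ℝ → ℂ := IccExtend (zero_le_one' ℝ) ((Icc (0 : ℝ) 1).domRestrict p) with hpe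
  have hpec : Continuous pe := (continuousOn_iff_continuous_domRestrict.1 hp).Icc_extend'
  have hpeq : ∀ x ∈ Icc (0 : ℝ) 1, pe x = p x := fun x hx => by
    rw [hpe, IccExtend_of_mem _ _ hx]; rfl
  obtain ⟨P, hP⟩ := isCompact_Icc.exists_bound_of_continuousOn hp
  have hPe : ∀ x, ‖pe x‖ ≤ P := fun x => hP _ (projIcc 0 1 (zero_le_one' ℝ) x).2
  have hP0 : 0 ≤ P := (norm_nonneg _).trans (hPe 0)
  -- Chosen so that κ ≥ 1 and P/κ² ≤ 1/2, the contraction constant.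
  set κ : ℝ := 1 + 2 * P with hκ
  have hκ1 : 1 ≤ κ := by linarith
  have hκ0 : 0 < κ := by linarith
  -- The unknown f stands for exp(-κs) y(s): the exponentially weighted norm becomes the plain sup
  -- norm.
  let F : C(Icc (0 : ℝ) 1, ℂ) → ℝ → ℂ := fun f w =>
    pe w * Real.exp (κ * w) * f (projIcc 0 1 (zero_le_one' ℝ) w)
  have hFc : ∀ f, Continuous (F f) := fun f => by
    have : Continuous fun w => f (projIcc 0 1 (zero_le_one' ℝ) w) :=
      f.continuous.comp continuous_projIcc
    have h2 : Continuous fun w : ℝ => ((Real.exp (κ * w) : ℝ) : ℂ) := by fun_prop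
    exact (hpec.mul h2).mul this
  let D : C(Icc (0 : ℝ) 1, ℂ) → ℝ → ℂ := fun f u => b + ∫ w in (0 : ℝ)..u, F f w
  have hDd : ∀ f u, HasDerivAt (D f) (F f u) u := fun f u =>
    (intervalIntegral.integral_hasDerivAt_right ((hFc f).intervalIntegrable _ _)
      ((hFc f).stronglyMeasurableAtFilter _ _) (hFc f).continuousAt).const_add b
  have hDc : ∀ f, Continuous (D f) := fun f =>
    continuous_iff_continuousAt.2 fun u => (hDd f u).continuousAt
  let Y : C(Icc (0 : ℝ) 1, ℂ) → ℝ → ℂ := fun f s => a + ∫ u in (0 : ℝ)..s, D f u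
  have hYd : ∀ f s, HasDerivAt (Y f) (D f s) s := fun f s =>
    (intervalIntegral.integral_hasDerivAt_right ((hDc f).intervalIntegrable _ _)
      ((hDc f).stronglyMeasurableAtFilter _ _) (hDc f).continuousAt).const_add a
  have hYc : ∀ f, Continuous (Y f) := fun f =>
    continuous_iff_continuousAt.2 fun u => (hYd f u).continuousAt
  let Φ : C(Icc (0 : ℝ) 1, ℂ) → C(Icc (0 : ℝ) 1, ℂ) := fun f =>
    ⟨fun s => Real.exp (-(κ * s)) * Y f s, by
      have := hYc f
      fun_prop⟩
  have hΦ : ContractingWith (1 / 2) Φ := by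
    refine ⟨by rw [← NNReal.coe_lt_coe]; norm_num, LipschitzWith.of_dist_le_mul fun f g => ?_⟩
    rw [ContinuousMap.dist_le (by positivity)]
    intro s
    set d := dist f g with hd
    have hd0 : 0 ≤ d := dist_nonneg
    have hF : ∀ w, 0 ≤ w → ‖F f w - F g w‖ ≤ P * d * Real.exp (κ * w) := by
      intro w _
      have h1 : F f w - F g w = pe w * Real.exp (κ * w) *
          (f (projIcc 0 1 (zero_le_one' ℝ) w) - g (projIcc 0 1 (zero_le_one' ℝ) w)) := by
        simp only [F]; ring
      rw [h1, norm_mul, norm_mul, Complex.norm_real, Real.norm_of_nonneg (Real.exp_pos _).le,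
        ← dist_eq_norm]
      calc _ ≤ P * Real.exp (κ * w) * d := by
            gcongr
            · exact hPe w
            · exact ContinuousMap.dist_apply_le_dist _
        _ = _ := by ring
    have hD : ∀ u, 0 ≤ u → ‖D f u - D g u‖ ≤ P * d / κ * Real.exp (κ * u) := by
      intro u hu
      have h1 : D f u - D g u = ∫ w in (0 : ℝ)..u, (F f w - F g w) := by
        simp only [D]
        rw [intervalIntegral.integral_sub ((hFc f).intervalIntegrable _ _)
          ((hFc g).intervalIntegrable _ _)]
        ring
      rw [h1]
      exact norm_integral_le_of_norm_le_exp hκ0 (by positivity) hu hF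
    have hY : ‖Y f s - Y g s‖ ≤ P * d / κ / κ * Real.exp (κ * s) := by
      have h1 : Y f s - Y g s = ∫ w in (0 : ℝ)..s, (D f w - D g w) := by
        simp only [Y]
        rw [intervalIntegral.integral_sub ((hDc f).intervalIntegrable _ _)
          ((hDc g).intervalIntegrable _ _)]
        ring
      rw [h1]
      exact norm_integral_le_of_norm_le_exp hκ0 (by positivity) s.2.1 hD
    have h2 : dist (Φ f s) (Φ g s) = Real.exp (-(κ * s)) * ‖Y f s - Y g s‖ := by
      rw [dist_eq_norm]
      simp only [Φ, ContinuousMap.coe_mk]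
      rw [← mul_sub, norm_mul, Complex.norm_real, Real.norm_of_nonneg (Real.exp_pos _).le]
    rw [h2]
    calc _ ≤ Real.exp (-(κ * s)) * (P * d / κ / κ * Real.exp (κ * s)) := by gcongr
      _ = P * d / κ / κ := by
        rw [Real.exp_neg]
        field_simp
      _ ≤ 1 / 2 * d := by
        rw [div_div, div_le_iff₀ (by positivity)]
        have : 2 * P ≤ κ * κ := by nlinarith
        nlinarith
  set f := ContractingWith.fixedPoint Φ hΦ with hf
  have hfix : Φ f = f := hΦ.fixedPoint_isFixedPt
  have hfY : ∀ x (hx : x ∈ Icc (0 : ℝ) 1), Real.exp (κ * x) * f ⟨x, hx⟩ = Y f x := by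
    intro x hx
    have h1 : f ⟨x, hx⟩ = Real.exp (-(κ * x)) * Y f x := by
      conv_lhs => rw [← hfix]
      rfl
    rw [h1, ← mul_assoc, ← Complex.ofReal_mul, ← Real.exp_add]
    simp
  refine ⟨Y f, D f, fun x hx => ⟨(hYd f x).hasDerivWithinAt, ?_⟩, by simp [Y], by simp [D]⟩
  refine ((hDd f x).congr_deriv ?_).hasDerivWithinAt
  simp only [F]
  rw [projIcc_of_mem _ hx, mul_assoc, hfY x hx, hpeq x hx]

theorem eq_of_hasDerivWithinAt_zero {f : ℝ → ℂ}
    (hf : ∀ x ∈ Icc (0 : ℝ) 1, HasDerivWithinAt f 0 (Icc 0 1) x) {x y : ℝ}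
    (hx : x ∈ Icc (0 : ℝ) 1) (hy : y ∈ Icc (0 : ℝ) 1) : f x = f y := by
  have := (convex_Icc (0 : ℝ) 1).norm_image_sub_le_of_norm_hasDerivWithin_le (C := 0) hf
    (fun x _ => by simp) hy hx
  rw [zero_mul] at this
  exact sub_eq_zero.1 (norm_le_zero_iff.1 this)

/-! ### Wronskians, uniqueness, and dependence on the spectral parameter -/

namespace NonlocalBVP

variable {L : NonlocalBVP} {k : ℂ}

theorem IsSolution.lin {y y' z z' : ℝ → ℂ} (hy : L.IsSolution k y y') (hz : L.IsSolution k z z')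
    (a b : ℂ) :
    L.IsSolution k (fun x => a * y x + b * z x) (fun x => a * y' x + b * z' x) := fun x hx => by
  obtain ⟨h1, h2⟩ := hy x hx
  obtain ⟨h3, h4⟩ := hz x hx
  refine ⟨(h1.const_mul a).add (h3.const_mul b), ?_⟩
  refine ((h2.const_mul a).add (h4.const_mul b)).congr_deriv ?_
  ring

theorem IsSolution.continuousOn {y y' : ℝ → ℂ} (hy : L.IsSolution k y y') :
    ContinuousOn y (Icc 0 1) := fun x hx => (hy x hx).1.continuousWithinAt

theorem IsSolution.continuousOn_deriv {y y' : ℝ → ℂ} (hy : L.IsSolution k y y') :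
    ContinuousOn y' (Icc 0 1) := fun x hx => (hy x hx).2.continuousWithinAt

theorem IsSolution.wronskian {y y' z z' : ℝ → ℂ} (hy : L.IsSolution k y y')
    (hz : L.IsSolution k z z') {s t : ℝ} (hs : s ∈ Icc (0 : ℝ) 1) (ht : t ∈ Icc (0 : ℝ) 1) :
    y s * z' s - y' s * z s = y t * z' t - y' t * z t := by
  refine eq_of_hasDerivWithinAt_zero (f := fun x => y x * z' x - y' x * z x) (fun x hx => ?_) hs ht
  obtain ⟨h1, h2⟩ := hy x hx
  obtain ⟨h3, h4⟩ := hz x hx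
  refine ((h1.mul h4).sub (h2.mul h3)).congr_deriv ?_
  ring

theorem cauchySol_spec (hq : ContinuousOn L.q (Icc 0 1)) (a b k : ℂ) :
    L.IsSolution k (L.cauchySol a b k).1 (L.cauchySol a b k).2 ∧
      (L.cauchySol a b k).1 0 = a ∧ (L.cauchySol a b k).2 0 = b := by
  have hp : ContinuousOn (fun x => (L.q x : ℂ) - k) (Icc 0 1) :=
    (Complex.continuous_ofReal.comp_continuousOn hq).sub continuousOn_const
  obtain ⟨y, y', h1, h2, h3⟩ := exists_solution_second_order hp a b
  exact Classical.epsilon_spec (p := fun Y : (ℝ → ℂ) × (ℝ → ℂ) =>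
    L.IsSolution k Y.1 Y.2 ∧ Y.1 0 = a ∧ Y.2 0 = b) ⟨(y, y'), h1, h2, h3⟩

theorem wronskian_cauchySol (hq : ContinuousOn L.q (Icc 0 1)) (k : ℂ) {x : ℝ}
    (hx : x ∈ Icc (0 : ℝ) 1) :
    (L.cauchySol 1 0 k).1 x * (L.cauchySol 0 1 k).2 x
      - (L.cauchySol 1 0 k).2 x * (L.cauchySol 0 1 k).1 x = 1 := by
  obtain ⟨hC, hC0, hC0'⟩ := cauchySol_spec hq 1 0 k
  obtain ⟨hS, hS0, hS0'⟩ := cauchySol_spec hq 0 1 k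
  rw [hC.wronskian hS hx (left_mem_Icc.2 zero_le_one), hC0, hC0', hS0, hS0']
  ring

/-- The Wronskians of y with C and with S are constant, hence zero; they form a linear system for
(y, y') of determinant one. -/
theorem IsSolution.eq_zero (hq : ContinuousOn L.q (Icc 0 1)) {y y' : ℝ → ℂ}
    (hy : L.IsSolution k y y') {s : ℝ} (hs : s ∈ Icc (0 : ℝ) 1) (h0 : y s = 0) (h0' : y' s = 0)
    {x : ℝ} (hx : x ∈ Icc (0 : ℝ) 1) : y x = 0 ∧ y' x = 0 := by
  have h1 := hy.wronskian (cauchySol_spec hq 1 0 k).1 hx hs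
  have h2 := hy.wronskian (cauchySol_spec hq 0 1 k).1 hx hs
  have hW := wronskian_cauchySol hq k hx
  rw [h0, h0', zero_mul, zero_mul, sub_zero] at h1 h2
  constructor
  · linear_combination (L.cauchySol 1 0 k).1 x * h2 - (L.cauchySol 0 1 k).1 x * h1 - y x * hW
  · linear_combination (L.cauchySol 1 0 k).2 x * h2 - (L.cauchySol 0 1 k).2 x * h1 - y' x * hW

theorem IsSolution.eqOn (hq : ContinuousOn L.q (Icc 0 1)) {y y' z z' : ℝ → ℂ}
    (hy : L.IsSolution k y y') (hz : L.IsSolution k z z') {s : ℝ} (hs : s ∈ Icc (0 : ℝ) 1)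
    (h0 : y s = z s) (h0' : y' s = z' s)
    {x : ℝ} (hx : x ∈ Icc (0 : ℝ) 1) : y x = z x ∧ y' x = z' x := by
  have := (hy.lin hz 1 (-1)).eq_zero hq hs (by simp [h0]) (by simp [h0']) hx
  exact ⟨by linear_combination this.1, by linear_combination this.2⟩

/-- Comparison of solutions of the equation for two values of the spectral parameter. -/
theorem cauchySol_sub (hq : ContinuousOn L.q (Icc 0 1)) (a b k μ : ℂ) {x : ℝ}
    (hx : x ∈ Icc (0 : ℝ) 1) :
    (L.cauchySol a b k).1 x - (L.cauchySol a b μ).1 x = (μ - k) *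
      ∫ u in (0 : ℝ)..x, ((L.cauchySol 0 1 μ).1 x * (L.cauchySol 1 0 μ).1 u -
        (L.cauchySol 1 0 μ).1 x * (L.cauchySol 0 1 μ).1 u) * (L.cauchySol a b k).1 u := by
  obtain ⟨hy, hy0, hy0'⟩ := cauchySol_spec hq a b k
  obtain ⟨hm, hm0, hm0'⟩ := cauchySol_spec hq a b μ
  obtain ⟨hC, hC0, hC0'⟩ := cauchySol_spec hq 1 0 μ
  obtain ⟨hS, hS0, hS0'⟩ := cauchySol_spec hq 0 1 μ
  have hW := wronskian_cauchySol hq μ hx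
  have hmx : (L.cauchySol a b μ).1 x = a * (L.cauchySol 1 0 μ).1 x + b * (L.cauchySol 0 1 μ).1 x :=
    (hm.eqOn hq (hC.lin hS a b) (left_mem_Icc.2 zero_le_one) (by simp [hm0, hC0, hS0])
      (by simp [hm0', hC0', hS0']) hx).1
  set y := (L.cauchySol a b k).1
  set y' := (L.cauchySol a b k).2
  set C := (L.cauchySol 1 0 μ).1
  set C' := (L.cauchySol 1 0 μ).2
  set S := (L.cauchySol 0 1 μ).1
  set S' := (L.cauchySol 0 1 μ).2
  have hsub : Icc 0 x ⊆ Icc (0 : ℝ) 1 := Icc_subset_Icc_right hx.2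
  -- The kernel K(u) = S(x)C(u) - C(x)S(u) solves the equation for μ and vanishes at u = x; the
  -- derivative of y'K - yK' is (μ - k)Ky.
  have hK := hC.lin hS (S x) (-C x)
  have hint : (∫ u in (0 : ℝ)..x, (μ - k) * ((S x * C u - C x * S u) * y u)) =
      (y' x * (S x * C x + -C x * S x) - y x * (S x * C' x + -C x * S' x))
      - (y' 0 * (S x * C 0 + -C x * S 0) - y 0 * (S x * C' 0 + -C x * S' 0)) := by
    refine intervalIntegral.integral_eq_sub_of_hasDerivAt_of_le (f := fun u =>
      y' u * (S x * C u + -C x * S u) - y u * (S x * C' u + -C x * S' u)) hx.1 ?_ ?_ ?_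
    · exact (((hy.continuousOn_deriv.mul hK.continuousOn).sub
        (hy.continuousOn.mul hK.continuousOn_deriv))).mono hsub
    · intro u hu
      have hu1 : u ∈ Icc (0 : ℝ) 1 := hsub (Ioo_subset_Icc_self hu)
      have hnhds : Icc (0 : ℝ) 1 ∈ 𝓝 u := Icc_mem_nhds hu.1 (hu.2.trans_le hx.2)
      have h1 := hy u hu1
      have h2 := hK u hu1
      have := ((h1.2.mul h2.1).sub (h1.1.mul h2.2)).hasDerivAt hnhds
      refine this.congr_deriv ?_
      ring
    · apply ContinuousOn.intervalIntegrable_of_Icc hx.1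
      have h1 := hy.continuousOn.mono hsub
      have h2 := hC.continuousOn.mono hsub
      have h3 := hS.continuousOn.mono hsub
      fun_prop
  rw [← intervalIntegral.integral_const_mul, hint, hmx]
  rw [hy0, hy0', hC0, hC0', hS0, hS0']
  linear_combination (-y x) * hW

/-- Iterating the identity `cauchySol_sub` once leaves a remainder quadratic in k - μ, provided the
solutions are bounded uniformly for k near μ. -/
theorem differentiableAt_cauchySol (hq : ContinuousOn L.q (Icc 0 1)) (a b μ : ℂ) {x : ℝ}
    (hx : x ∈ Icc (0 : ℝ) 1) :
    DifferentiableAt ℂ (fun k => (L.cauchySol a b k).1 x) μ := by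
  obtain ⟨hm, -, -⟩ := cauchySol_spec hq a b μ
  obtain ⟨hC, -, -⟩ := cauchySol_spec hq 1 0 μ
  obtain ⟨hS, -, -⟩ := cauchySol_spec hq 0 1 μ
  have hsol := fun k => (cauchySol_spec hq a b k).1
  obtain ⟨M1, hM1⟩ := isCompact_Icc.exists_bound_of_continuousOn hC.continuousOn
  obtain ⟨M2, hM2⟩ := isCompact_Icc.exists_bound_of_continuousOn hS.continuousOn
  obtain ⟨B, hB⟩ := isCompact_Icc.exists_bound_of_continuousOn hm.continuousOn
  have h0mem : (0 : ℝ) ∈ Icc (0 : ℝ) 1 := left_mem_Icc.2 zero_le_one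
  have hM10 : 0 ≤ M1 := (norm_nonneg _).trans (hM1 0 h0mem)
  have hM20 : 0 ≤ M2 := (norm_nonneg _).trans (hM2 0 h0mem)
  have hB0 : 0 ≤ B := (norm_nonneg _).trans (hB 0 h0mem)
  set M := 2 * M1 * M2 with hM
  have hM0 : 0 ≤ M := by positivity
  let K : ℝ → ℝ → ℂ := fun x u => (L.cauchySol 0 1 μ).1 x * (L.cauchySol 1 0 μ).1 u -
    (L.cauchySol 1 0 μ).1 x * (L.cauchySol 0 1 μ).1 u
  have hK : ∀ x ∈ Icc (0 : ℝ) 1, ∀ u ∈ Icc (0 : ℝ) 1, ‖K x u‖ ≤ M := by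
    intro x hx u hu
    calc ‖K x u‖ ≤ ‖(L.cauchySol 0 1 μ).1 x * (L.cauchySol 1 0 μ).1 u‖ +
          ‖(L.cauchySol 1 0 μ).1 x * (L.cauchySol 0 1 μ).1 u‖ := norm_sub_le _ _
      _ ≤ M2 * M1 + M1 * M2 := by
          rw [norm_mul, norm_mul]
          gcongr
          · exact hM2 x hx
          · exact hM1 u hu
          · exact hM1 x hx
          · exact hM2 u hu
      _ = M := by rw [hM]; ring
  have hIbound : ∀ x ∈ Icc (0 : ℝ) 1, ∀ f : ℝ → ℂ, ∀ c, 0 ≤ c → (∀ u ∈ Icc (0 : ℝ) 1, ‖f u‖ ≤ c) →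
      ‖∫ u in (0 : ℝ)..x, K x u * f u‖ ≤ M * c := by
    intro x hx f c hc hf
    have := intervalIntegral.norm_integral_le_of_norm_le_const (a := 0) (b := x) (C := M * c)
      (f := fun u => K x u * f u) (fun u hu => by
        rw [uIoc_of_le hx.1] at hu
        have hu1 : u ∈ Icc (0 : ℝ) 1 := ⟨hu.1.le, hu.2.trans hx.2⟩
        rw [norm_mul]
        exact mul_le_mul (hK x hx u hu1) (hf u hu1) (norm_nonneg _) hM0)
    refine this.trans ?_
    rw [sub_zero, abs_of_nonneg hx.1]
    exact mul_le_of_le_one_right (by positivity) hx.2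
  -- a locally uniform bound
  have hbound : ∀ k, ‖k - μ‖ * M ≤ 1 / 2 → ∀ u ∈ Icc (0 : ℝ) 1,
      ‖(L.cauchySol a b k).1 u‖ ≤ 2 * B := by
    intro k hk
    -- At the point of maximal modulus the identity bounds the maximum by B plus half of itself.
    obtain ⟨x0, hx0, hmax⟩ := isCompact_Icc.exists_isMaxOn ⟨0, h0mem⟩ (hsol k).continuousOn.norm
    have h1 : ‖(L.cauchySol a b k).1 x0‖ ≤ B + ‖k - μ‖ * (M * ‖(L.cauchySol a b k).1 x0‖) := by
      have h2 := cauchySol_sub hq a b k μ hx0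
      rw [sub_eq_iff_eq_add] at h2
      have h3 := hIbound x0 hx0 _ _ (norm_nonneg _) (fun u hu => hmax hu)
      calc _ ≤ ‖(μ - k) * ∫ u in (0 : ℝ)..x0, K x0 u * (L.cauchySol a b k).1 u‖ +
            ‖(L.cauchySol a b μ).1 x0‖ := by
              conv_lhs => rw [h2]
              exact norm_add_le _ _
        _ ≤ ‖k - μ‖ * (M * ‖(L.cauchySol a b k).1 x0‖) + B := by
            rw [norm_mul, norm_sub_rev μ k]
            gcongr
            exact hB x0 hx0
        _ = _ := by ring
    have h4 : ‖(L.cauchySol a b k).1 x0‖ ≤ 2 * B := by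
      have := mul_le_mul_of_nonneg_right hk (norm_nonneg ((L.cauchySol a b k).1 x0))
      linarith
    exact fun u hu => (hmax hu).trans h4
  set D : ℂ := -∫ u in (0 : ℝ)..x, K x u * (L.cauchySol a b μ).1 u with hD
  have hest : ∀ k, ‖k - μ‖ * M ≤ 1 / 2 →
      ‖(L.cauchySol a b k).1 x - (L.cauchySol a b μ).1 x - (k - μ) * D‖
        ≤ (M * (M * (2 * B))) * ‖k - μ‖ ^ 2 := by
    intro k hk
    have hdiff : ∀ u ∈ Icc (0 : ℝ) 1,
        ‖(L.cauchySol a b k).1 u - (L.cauchySol a b μ).1 u‖ ≤ ‖k - μ‖ * (M * (2 * B)) := by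
      intro u hu
      rw [cauchySol_sub hq a b k μ hu, norm_mul, norm_sub_rev μ k]
      gcongr
      exact hIbound u hu _ _ (by positivity) (hbound k hk)
    have hsub : Icc 0 x ⊆ Icc (0 : ℝ) 1 := Icc_subset_Icc_right hx.2
    have hint : ∀ k', IntervalIntegrable (fun u => K x u * (L.cauchySol a b k').1 u)
        volume 0 x := by
      intro k'
      apply ContinuousOn.intervalIntegrable_of_Icc hx.1
      have h1 := (hsol k').continuousOn.mono hsub
      have h2 := hC.continuousOn.mono hsub
      have h3 := hS.continuousOn.mono hsub
      simp only [K]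
      fun_prop
    have heq : (L.cauchySol a b k).1 x - (L.cauchySol a b μ).1 x - (k - μ) * D = (μ - k) *
        ∫ u in (0 : ℝ)..x, K x u * ((L.cauchySol a b k).1 u - (L.cauchySol a b μ).1 u) := by
      rw [cauchySol_sub hq a b k μ hx, hD]
      simp_rw [mul_sub (K x _)]
      rw [intervalIntegral.integral_sub (hint k) (hint μ)]
      ring
    rw [heq, norm_mul, norm_sub_rev μ k]
    have := hIbound x hx _ _ (by positivity) hdiff
    calc _ ≤ ‖k - μ‖ * (M * (‖k - μ‖ * (M * (2 * B)))) := by gcongr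
      _ = _ := by ring
  refine HasDerivAt.differentiableAt (f' := D) ?_
  rw [hasDerivAt_iff_isLittleO]
  have hev : ∀ᶠ k in 𝓝 μ, ‖k - μ‖ * M ≤ 1 / 2 := by
    have : Tendsto (fun k => ‖k - μ‖ * M) (𝓝 μ) (𝓝 (‖μ - μ‖ * M)) := by
      apply Continuous.tendsto; fun_prop
    rw [sub_self, norm_zero, zero_mul] at this
    exact this.eventually (eventually_le_nhds (by norm_num))
  have hO : (fun k => (L.cauchySol a b k).1 x - (L.cauchySol a b μ).1 x - (k - μ) • D)
      =O[𝓝 μ] fun k => (k - μ) ^ 2 := by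
    refine Asymptotics.IsBigO.of_bound (M * (M * (2 * B))) (hev.mono fun k hk => ?_)
    rw [norm_pow]
    exact hest k hk
  refine hO.trans_isLittleO ?_
  have := (Asymptotics.isLittleO_pow_sub_sub μ one_lt_two (m := 2))
  exact (this.congr_left fun k => (norm_pow (k - μ) 2).symm).of_norm_left

theorem charFun_eq (k : ℂ) (hq : ContinuousOn L.q (Icc 0 1)) : L.charFun k =
    (L.h - L.γ * (L.cauchySol 1 0 k).1 (L.ξ : ℝ)) * (L.cauchySol 0 1 k).1 1
      - (1 - L.γ * (L.cauchySol 0 1 k).1 (L.ξ : ℝ)) * (L.cauchySol 1 0 k).1 1 := by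
  obtain ⟨-, hC0, hC0'⟩ := cauchySol_spec hq 1 0 k
  obtain ⟨-, hS0, hS0'⟩ := cauchySol_spec hq 0 1 k
  simp only [charFun, U, V, hC0, hC0', hS0, hS0']
  ring

theorem differentiable_charFun (hq : ContinuousOn L.q (Icc 0 1)) (h0 : 0 < L.ξ) (h1 : L.ξ < 1) :
    Differentiable ℂ L.charFun := by
  have hξ : (L.ξ : ℝ) ∈ Icc (0 : ℝ) 1 := ⟨by exact_mod_cast h0.le, by exact_mod_cast h1.le⟩
  have h1m : (1 : ℝ) ∈ Icc (0 : ℝ) 1 := right_mem_Icc.2 zero_le_one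
  intro μ
  rw [show L.charFun = _ from funext fun k => charFun_eq k hq]
  have e1 := differentiableAt_cauchySol hq 1 0 μ hξ
  have e2 := differentiableAt_cauchySol hq 0 1 μ hξ
  have e3 := differentiableAt_cauchySol hq 1 0 μ h1m
  have e4 := differentiableAt_cauchySol hq 0 1 μ h1m
  fun_prop

/-! ### The solution vanishing at the right end point -/

theorem one_sub_mem_Icc {s : ℝ} (hs : s ∈ Icc (0 : ℝ) 1) : 1 - s ∈ Icc (0 : ℝ) 1 :=
  ⟨by linarith [hs.2], by linarith [hs.1]⟩

/-- The solution vanishing at the right end point, as a function of the distance to that point. -/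
noncomputable def rightSol (L : NonlocalBVP) (k : ℂ) (s : ℝ) : ℂ :=
  (L.cauchySol 1 0 k).1 (1 - s) * (L.cauchySol 0 1 k).1 1
    - (L.cauchySol 0 1 k).1 (1 - s) * (L.cauchySol 1 0 k).1 1

/-- The derivative of `rightSol`. -/
noncomputable def rightSolDeriv (L : NonlocalBVP) (k : ℂ) (s : ℝ) : ℂ :=
  -((L.cauchySol 1 0 k).2 (1 - s) * (L.cauchySol 0 1 k).1 1
    - (L.cauchySol 0 1 k).2 (1 - s) * (L.cauchySol 1 0 k).1 1)

theorem isSolution_rightSol (hq : ContinuousOn L.q (Icc 0 1)) (k : ℂ) :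
    L.IsSolution k (fun x => L.rightSol k (1 - x)) (fun x => -L.rightSolDeriv k (1 - x)) := by
  have h := (cauchySol_spec hq 1 0 k).1.lin (cauchySol_spec hq 0 1 k).1
    ((L.cauchySol 0 1 k).1 1) (-(L.cauchySol 1 0 k).1 1)
  have e1 : (fun x => L.rightSol k (1 - x)) = fun x => (L.cauchySol 0 1 k).1 1 *
      (L.cauchySol 1 0 k).1 x + -(L.cauchySol 1 0 k).1 1 * (L.cauchySol 0 1 k).1 x := by
    ext x; simp only [rightSol, sub_sub_cancel]; ring
  have e2 : (fun x => -L.rightSolDeriv k (1 - x)) = fun x => (L.cauchySol 0 1 k).1 1 *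
      (L.cauchySol 1 0 k).2 x + -(L.cauchySol 1 0 k).1 1 * (L.cauchySol 0 1 k).2 x := by
    ext x; simp only [rightSolDeriv, sub_sub_cancel]; ring
  rw [e1, e2]
  exact h

theorem rightSol_zero (k : ℂ) : L.rightSol k 0 = 0 := by
  simp only [rightSol, sub_zero]; ring

theorem rightSolDeriv_zero (hq : ContinuousOn L.q (Icc 0 1)) (k : ℂ) :
    L.rightSolDeriv k 0 = 1 := by
  have := wronskian_cauchySol hq k (right_mem_Icc.2 zero_le_one)
  simp only [rightSolDeriv, sub_zero]
  linear_combination this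

theorem hasDerivWithinAt_comp_one_sub {f : ℝ → ℂ} {f' : ℂ} {s : ℝ}
    (hf : HasDerivWithinAt f f' (Icc 0 1) (1 - s)) :
    HasDerivWithinAt (fun s => f (1 - s)) (-f') (Icc 0 1) s := by
  have h1 : HasDerivWithinAt (fun s : ℝ => 1 - s) (-1) (Icc 0 1) s := by
    simpa using (hasDerivWithinAt_id s (Icc (0 : ℝ) 1)).const_sub 1
  have := hf.scomp s h1 (fun s hs => one_sub_mem_Icc hs)
  refine this.congr_deriv ?_
  simp

theorem hasDerivWithinAt_rightSol (hq : ContinuousOn L.q (Icc 0 1)) (k : ℂ) {s : ℝ}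
    (hs : s ∈ Icc (0 : ℝ) 1) :
    HasDerivWithinAt (L.rightSol k) (L.rightSolDeriv k s) (Icc 0 1) s ∧
    HasDerivWithinAt (L.rightSolDeriv k) (((L.q (1 - s) : ℂ) - k) * L.rightSol k s)
      (Icc 0 1) s := by
  obtain ⟨h1, h2⟩ := isSolution_rightSol hq k (1 - s) (one_sub_mem_Icc hs)
  have h3 := hasDerivWithinAt_comp_one_sub h1
  have h4 := (hasDerivWithinAt_comp_one_sub h2).fun_neg
  simp only [sub_sub_cancel, neg_neg] at h3 h4
  exact ⟨h3, h4⟩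

theorem continuousOn_rightSol (hq : ContinuousOn L.q (Icc 0 1)) (k : ℂ) :
    ContinuousOn (L.rightSol k) (Icc 0 1) :=
  fun _ hs => (hasDerivWithinAt_rightSol hq k hs).1.continuousWithinAt

theorem continuousOn_rightSolDeriv (hq : ContinuousOn L.q (Icc 0 1)) (k : ℂ) :
    ContinuousOn (L.rightSolDeriv k) (Icc 0 1) :=
  fun _ hs => (hasDerivWithinAt_rightSol hq k hs).2.continuousWithinAt

/-- The function `rightSol` at 1 - x is C(x)S(1) - S(x)C(1), so Δ is U applied to it by linearity;
the derivative changes sign because s = 1 - x. -/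
theorem charFun_eq_rightSol (hq : ContinuousOn L.q (Icc 0 1)) (k : ℂ) :
    L.charFun k = -L.rightSolDeriv k 1 + L.h * L.rightSol k 1
      - L.γ * L.rightSol k (1 - (L.ξ : ℝ)) := by
  obtain ⟨-, hC0, hC0'⟩ := cauchySol_spec hq 1 0 k
  obtain ⟨-, hS0, hS0'⟩ := cauchySol_spec hq 0 1 k
  rw [charFun_eq k hq]
  simp only [rightSol, rightSolDeriv, sub_self, hC0, hC0', hS0, hS0', sub_sub_cancel]
  ring

theorem IsSolution.eq_const_mul_rightSol (hq : ContinuousOn L.q (Icc 0 1)) {y y' : ℝ → ℂ}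
    (hy : L.IsSolution k y y') (h1 : y 1 = 0) {x : ℝ} (hx : x ∈ Icc (0 : ℝ) 1) :
    y x = -y' 1 * L.rightSol k (1 - x) ∧ y' x = y' 1 * L.rightSolDeriv k (1 - x) := by
  have h := hy.eqOn hq ((isSolution_rightSol hq k).lin (isSolution_rightSol hq k) (-y' 1) 0)
    (right_mem_Icc.2 zero_le_one) (by simp [h1, rightSol_zero])
    (by simp [rightSolDeriv_zero hq]) hx
  constructor
  · rw [h.1]; ring
  · rw [h.2]; ring

/-- Every eigenfunction is a nonzero multiple of `rightSol`, so the nodes do not depend on its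
choice. Conversely Δ = 0 says that `rightSol` satisfies both boundary conditions; it is not
identically zero since its derivative at s = 0 is 1. -/
theorem nodes_eq (hq : ContinuousOn L.q (Icc 0 1)) (hk : L.charFun k = 0) :
    L.nodes k = {x | x ∈ Ioo (0 : ℝ) 1 ∧ L.rightSol k (1 - x) = 0} := by
  ext x
  simp only [nodes, mem_ofPred_eq]
  refine and_congr_right fun hx => ⟨?_, fun h0 => ?_⟩
  · rintro ⟨y, y', ⟨hy, ⟨t, ht, hyt⟩, -, hV⟩, hyx⟩
    have h1 := (hy.eq_const_mul_rightSol hq hV (Ioo_subset_Icc_self hx)).1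
    have h2 := (hy.eq_const_mul_rightSol hq hV ht).1
    rw [hyx] at h1
    rcases mul_eq_zero.1 h1.symm with h3 | h3
    · rw [h2, h3, zero_mul] at hyt
      exact absurd rfl hyt
    · exact h3
  · refine ⟨_, _, ⟨isSolution_rightSol hq k, ?_, ?_, ?_⟩, h0⟩
    · by_contra hcon
      push Not at hcon
      have hz : ∀ s ∈ Icc (0 : ℝ) 1, L.rightSol k s = 0 := fun s hs => by
        simpa using hcon (1 - s) (one_sub_mem_Icc hs)
      have h0m : (0 : ℝ) ∈ Icc (0 : ℝ) 1 := left_mem_Icc.2 zero_le_one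
      have hd := (hasDerivWithinAt_rightSol hq k h0m).1
      have hd' : HasDerivWithinAt (L.rightSol k) 0 (Icc 0 1) 0 :=
        (hasDerivWithinAt_const (0 : ℝ) (Icc (0 : ℝ) 1) (0 : ℂ)).congr hz (hz 0 h0m)
      have := (uniqueDiffOn_Icc_zero_one 0 h0m).eq_deriv _ hd hd'
      rw [rightSolDeriv_zero hq] at this
      exact one_ne_zero this
    · rw [charFun_eq_rightSol hq] at hk
      simp only [U, sub_zero]
      exact hk
    · simp [V, rightSol_zero]

theorem rightSolDeriv_ne_zero (hq : ContinuousOn L.q (Icc 0 1)) {s : ℝ} (hs : s ∈ Icc (0 : ℝ) 1)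
    (h0 : L.rightSol k s = 0) : L.rightSolDeriv k s ≠ 0 := by
  intro h0'
  have := ((isSolution_rightSol hq k).eq_zero hq (one_sub_mem_Icc hs) (by simpa using h0)
    (by simpa using h0') (right_mem_Icc.2 zero_le_one)).2
  simp [rightSolDeriv_zero hq] at this

theorem IsSolution.conj {y y' : ℝ → ℂ} (hy : L.IsSolution k y y') :
    L.IsSolution (starRingEnd ℂ k) (fun x => starRingEnd ℂ (y x))
      (fun x => starRingEnd ℂ (y' x)) := fun x hx => by
  obtain ⟨h1, h2⟩ := hy x hx
  refine ⟨h1.star, h2.star.congr_deriv ?_⟩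
  simp

theorem rightSol_conj (hq : ContinuousOn L.q (Icc 0 1)) (k : ℂ) {s : ℝ}
    (hs : s ∈ Icc (0 : ℝ) 1) :
    L.rightSol (starRingEnd ℂ k) s = starRingEnd ℂ (L.rightSol k s) ∧
    L.rightSolDeriv (starRingEnd ℂ k) s = starRingEnd ℂ (L.rightSolDeriv k s) := by
  have h := (isSolution_rightSol hq (starRingEnd ℂ k)).eqOn hq (isSolution_rightSol hq k).conj
    (right_mem_Icc.2 zero_le_one) (by simp [rightSol_zero])
    (by simp [rightSolDeriv_zero hq]) (one_sub_mem_Icc hs)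
  simpa using h

theorem charFun_conj (hq : ContinuousOn L.q (Icc 0 1)) (h0 : 0 < L.ξ) (h1 : L.ξ < 1) (k : ℂ) :
    L.charFun (starRingEnd ℂ k) = starRingEnd ℂ (L.charFun k) := by
  have hξ : (L.ξ : ℝ) ∈ Icc (0 : ℝ) 1 := ⟨by exact_mod_cast h0.le, by exact_mod_cast h1.le⟩
  have h1m : (1 : ℝ) ∈ Icc (0 : ℝ) 1 := right_mem_Icc.2 zero_le_one
  rw [charFun_eq_rightSol hq, charFun_eq_rightSol hq, (rightSol_conj hq k h1m).1,
    (rightSol_conj hq k h1m).2, (rightSol_conj hq k (one_sub_mem_Icc hξ)).1]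
  simp

end NonlocalBVP

/-! ### Bounds for complex sine and cosine -/

theorem norm_exp_mul_I_le (w : ℂ) : ‖Complex.exp (w * Complex.I)‖ ≤ Real.exp |w.im| := by
  rw [Complex.norm_exp]
  apply Real.exp_le_exp.2
  simpa using neg_le_abs w.im

theorem norm_sin_le_exp (w : ℂ) : ‖Complex.sin w‖ ≤ Real.exp |w.im| := by
  have h1 := norm_exp_mul_I_le w
  have h2 := norm_exp_mul_I_le (-w)
  rw [Complex.neg_im, abs_neg] at h2
  have h3 := norm_sub_le (Complex.exp (-w * Complex.I)) (Complex.exp (w * Complex.I))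
  rw [Complex.sin, norm_div, norm_mul, Complex.norm_I, mul_one, Complex.norm_ofNat]
  linarith

theorem norm_cos_le_exp (w : ℂ) : ‖Complex.cos w‖ ≤ Real.exp |w.im| := by
  have h1 := norm_exp_mul_I_le w
  have h2 := norm_exp_mul_I_le (-w)
  rw [Complex.neg_im, abs_neg] at h2
  have h3 := norm_add_le (Complex.exp (w * Complex.I)) (Complex.exp (-w * Complex.I))
  rw [Complex.cos, norm_div, Complex.norm_ofNat]
  linarith

theorem norm_cos_sq (w : ℂ) : ‖Complex.cos w‖ ^ 2 = Real.cos w.re ^ 2 + Real.sinh w.im ^ 2 := by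
  have h : Complex.cos w = Complex.cos (w.re + w.im * Complex.I) := by rw [Complex.re_add_im]
  rw [h, Complex.cos_add_mul_I, ← Complex.ofReal_cos, ← Complex.ofReal_sin, ← Complex.ofReal_cosh,
    ← Complex.ofReal_sinh, ← Complex.normSq_eq_norm_sq, Complex.normSq_apply]
  simp only [Complex.sub_re, Complex.sub_im, Complex.mul_re, Complex.mul_im, Complex.ofReal_re,
    Complex.ofReal_im, Complex.I_re, Complex.I_im]
  have h1 := Real.cosh_sq w.im
  have h2 := Real.sin_sq_add_cos_sq w.re
  ring_nf
  rw [h1]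
  linear_combination (Real.sinh w.im ^ 2) * h2

/-- The circles |w| = Nπ stay away from the zeros of cos. In |cos w|² = cos²(Re w) + sinh²(Im w) the
second term suffices when |Im w| ≥ 1; otherwise |Re w| is within 1/3 of Nπ and cos²(Re w) ≥
(17/18)². -/
theorem exp_div_four_le_norm_cos {w : ℂ} {N : ℕ} (hN : 1 ≤ N) (hw : ‖w‖ = N * Real.pi) :
    Real.exp |w.im| / 4 ≤ ‖Complex.cos w‖ := by
  refine (sq_le_sq₀ (by positivity) (norm_nonneg _)).1 ?_
  rw [norm_cos_sq]
  have hsinh : Real.sinh w.im ^ 2 = Real.sinh |w.im| ^ 2 := by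
    rcases abs_cases w.im with h | h <;> rw [h.1]
    rw [Real.sinh_neg, neg_sq]
  rw [hsinh]
  have he1 := Real.exp_one_gt_d9
  have he2 := Real.exp_one_lt_d9
  set t := |w.im| with ht
  have ht0 : 0 ≤ t := abs_nonneg _
  rcases le_or_gt 1 t with h1 | h1
  · have h2 : Real.exp t / 4 ≤ Real.sinh t := by
      rw [Real.sinh_eq]
      have h3 : Real.exp 1 ≤ Real.exp t := Real.exp_le_exp.2 h1
      have h4 : Real.exp (-t) ≤ 1 := Real.exp_le_one_iff.2 (by linarith)
      linarith
    have h3 : (Real.exp t / 4) ^ 2 ≤ Real.sinh t ^ 2 := by gcongr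
    nlinarith [sq_nonneg (Real.cos w.re)]
  · have hexp : Real.exp t ≤ 2.7182818286 := (Real.exp_le_exp.2 h1.le).trans he2.le
    have hpi := Real.pi_gt_three
    have hN1 : (1 : ℝ) ≤ N := by exact_mod_cast hN
    have hNpi : 3 ≤ N * Real.pi := by nlinarith
    have hsq : w.re ^ 2 + t ^ 2 = (N * Real.pi) ^ 2 := by
      rw [← hw, ht, sq_abs, ← Complex.normSq_eq_norm_sq, Complex.normSq_apply]; ring
    set σ := |w.re| with hσ
    have hσ2 : w.re ^ 2 = σ ^ 2 := (sq_abs _).symm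
    have hσ0 : 0 ≤ σ := abs_nonneg _
    have hd0 : 0 ≤ N * Real.pi - σ := by
      rw [hσ2] at hsq
      nlinarith
    have hd1 : N * Real.pi - σ ≤ 1 / 3 := by
      rw [hσ2] at hsq
      nlinarith
    have hcos : Real.cos w.re ^ 2 = Real.cos (N * Real.pi - σ) ^ 2 := by
      rw [Real.cos_nat_mul_pi_sub, mul_pow, ← pow_mul, mul_comm N 2, pow_mul]
      simp [hσ]
    rw [hcos]
    have h5 := Real.one_sub_sq_div_two_le_cos (x := N * Real.pi - σ)
    have h6 : 17 / 18 ≤ Real.cos (N * Real.pi - σ) := by nlinarith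
    have h7 := Real.exp_pos t
    nlinarith [sq_nonneg (Real.sinh t)]

/-! ### Asymptotics of the characteristic function -/

namespace NonlocalBVP

variable {L : NonlocalBVP}

theorem continuousOn_potential (hq : ContinuousOn L.q (Icc 0 1)) :
    ContinuousOn (fun s => L.q (1 - s)) (Icc 0 1) :=
  hq.comp (by fun_prop) fun _ hs => one_sub_mem_Icc hs

/-- Variation of constants. -/
theorem rightSol_integral (hq : ContinuousOn L.q (Icc 0 1)) (ρ : ℂ) {s : ℝ}
    (hs : s ∈ Icc (0 : ℝ) 1) :
    ρ * L.rightSol (ρ ^ 2) s - Complex.sin (ρ * s) =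
      ∫ u in (0 : ℝ)..s, Complex.sin (ρ * (s - u)) * (L.q (1 - u) * L.rightSol (ρ ^ 2) u) := by
  have hsub : Icc 0 s ⊆ Icc (0 : ℝ) 1 := Icc_subset_Icc_right hs.2
  have hz := (continuousOn_rightSol hq (ρ ^ 2)).mono hsub
  have hz' := (continuousOn_rightSolDeriv hq (ρ ^ 2)).mono hsub
  have hQ : ContinuousOn (fun u => (L.q (1 - u) : ℂ)) (Icc 0 s) :=
    Complex.continuous_ofReal.comp_continuousOn ((continuousOn_potential hq).mono hsub)
  rw [intervalIntegral.integral_eq_sub_of_hasDerivAt_of_le (f := fun u : ℝ =>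
    Complex.sin (ρ * (s - u)) * L.rightSolDeriv (ρ ^ 2) u +
      ρ * Complex.cos (ρ * (s - u)) * L.rightSol (ρ ^ 2) u) hs.1]
  · simp [rightSol_zero, rightSolDeriv_zero hq]
  · fun_prop
  · intro u hu
    have hnhds : Icc (0 : ℝ) 1 ∈ 𝓝 u := Icc_mem_nhds hu.1 (hu.2.trans_le hs.2)
    obtain ⟨h1, h2⟩ := hasDerivWithinAt_rightSol hq (ρ ^ 2) (hsub (Ioo_subset_Icc_self hu))
    have h0 : HasDerivAt (fun u : ℂ => ρ * ((s : ℂ) - u)) (-ρ) (u : ℂ) := by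
      simpa using ((hasDerivAt_id (u : ℂ)).const_sub (s : ℂ)).const_mul ρ
    have := (h0.csin.comp_ofReal.mul (h2.hasDerivAt hnhds)).add
      ((h0.ccos.comp_ofReal.const_mul ρ).mul (h1.hasDerivAt hnhds))
    refine this.congr_deriv ?_
    ring
  · apply ContinuousOn.intervalIntegrable_of_Icc hs.1
    fun_prop

theorem rightSolDeriv_integral (hq : ContinuousOn L.q (Icc 0 1)) (ρ : ℂ) {s : ℝ}
    (hs : s ∈ Icc (0 : ℝ) 1) :
    L.rightSolDeriv (ρ ^ 2) s - Complex.cos (ρ * s) =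
      ∫ u in (0 : ℝ)..s, Complex.cos (ρ * (s - u)) * (L.q (1 - u) * L.rightSol (ρ ^ 2) u) := by
  have hsub : Icc 0 s ⊆ Icc (0 : ℝ) 1 := Icc_subset_Icc_right hs.2
  have hz := (continuousOn_rightSol hq (ρ ^ 2)).mono hsub
  have hz' := (continuousOn_rightSolDeriv hq (ρ ^ 2)).mono hsub
  have hQ : ContinuousOn (fun u => (L.q (1 - u) : ℂ)) (Icc 0 s) :=
    Complex.continuous_ofReal.comp_continuousOn ((continuousOn_potential hq).mono hsub)
  rw [intervalIntegral.integral_eq_sub_of_hasDerivAt_of_le (f := fun u : ℝ =>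
    Complex.cos (ρ * (s - u)) * L.rightSolDeriv (ρ ^ 2) u -
      ρ * Complex.sin (ρ * (s - u)) * L.rightSol (ρ ^ 2) u) hs.1]
  · simp [rightSol_zero, rightSolDeriv_zero hq]
  · fun_prop
  · intro u hu
    have hnhds : Icc (0 : ℝ) 1 ∈ 𝓝 u := Icc_mem_nhds hu.1 (hu.2.trans_le hs.2)
    obtain ⟨h1, h2⟩ := hasDerivWithinAt_rightSol hq (ρ ^ 2) (hsub (Ioo_subset_Icc_self hu))
    have h0 : HasDerivAt (fun u : ℂ => ρ * ((s : ℂ) - u)) (-ρ) (u : ℂ) := by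
      simpa using ((hasDerivAt_id (u : ℂ)).const_sub (s : ℂ)).const_mul ρ
    have := (h0.ccos.comp_ofReal.mul (h2.hasDerivAt hnhds)).sub
      ((h0.csin.comp_ofReal.const_mul ρ).mul (h1.hasDerivAt hnhds))
    refine this.congr_deriv ?_
    ring
  · apply ContinuousOn.intervalIntegrable_of_Icc hs.1
    fun_prop

/-- Let M be the maximum of exp(-|Im ρ| s)|z(s)|. Variation of constants at the maximising point
gives |ρ|M ≤ 1 + BM, and 2B ≤ |ρ| absorbs the last term, so M ≤ 2/|ρ|. -/
theorem norm_rightSol_estimates (hq : ContinuousOn L.q (Icc 0 1)) {B : ℝ}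
    (hB : ∀ x ∈ Icc (0 : ℝ) 1, |L.q x| ≤ B) {ρ : ℂ} (hρ : 0 < ‖ρ‖) (hρB : 2 * B ≤ ‖ρ‖) {s : ℝ}
    (hs : s ∈ Icc (0 : ℝ) 1) :
    ‖L.rightSol (ρ ^ 2) s‖ ≤ 2 / ‖ρ‖ * Real.exp (|ρ.im| * s) ∧
    ‖L.rightSolDeriv (ρ ^ 2) s - Complex.cos (ρ * s)‖ ≤ 2 * B / ‖ρ‖ * Real.exp (|ρ.im| * s) := by
  have h0m : (0 : ℝ) ∈ Icc (0 : ℝ) 1 := left_mem_Icc.2 zero_le_one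
  have hB0 : 0 ≤ B := (abs_nonneg _).trans (hB 0 h0m)
  set τ := |ρ.im| with hτ
  have hτ0 : 0 ≤ τ := abs_nonneg _
  obtain ⟨s0, hs0, hmax⟩ := isCompact_Icc.exists_isMaxOn (α := ℝ) ⟨0, h0m⟩
    (f := fun s => Real.exp (-(τ * s)) * ‖L.rightSol (ρ ^ 2) s‖)
    (by have := continuousOn_rightSol hq (ρ ^ 2); fun_prop)
  set M := Real.exp (-(τ * s0)) * ‖L.rightSol (ρ ^ 2) s0‖ with hM
  have hM0 : 0 ≤ M := by positivity
  have hz : ∀ s ∈ Icc (0 : ℝ) 1, ‖L.rightSol (ρ ^ 2) s‖ ≤ M * Real.exp (τ * s) := by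
    intro s hs
    have h1 : Real.exp (-(τ * s)) * ‖L.rightSol (ρ ^ 2) s‖ ≤ M := hmax hs
    calc ‖L.rightSol (ρ ^ 2) s‖
        = Real.exp (-(τ * s)) * ‖L.rightSol (ρ ^ 2) s‖ * Real.exp (τ * s) := by
          rw [Real.exp_neg]; field_simp
      _ ≤ _ := by gcongr
  have him : ∀ s u : ℝ, u ≤ s → |(ρ * ((s : ℂ) - u)).im| = τ * (s - u) := by
    intro s u hu
    rw [← Complex.ofReal_sub, Complex.im_mul_ofReal, abs_mul, abs_of_nonneg (sub_nonneg.2 hu)]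
  have hI : ∀ s ∈ Icc (0 : ℝ) 1, ∀ f : ℂ → ℂ, (∀ w, ‖f w‖ ≤ Real.exp |w.im|) →
      ‖∫ u in (0 : ℝ)..s, f (ρ * (s - u)) * (L.q (1 - u) * L.rightSol (ρ ^ 2) u)‖
        ≤ B * M * Real.exp (τ * s) := by
    intro s hs f hf
    have := intervalIntegral.norm_integral_le_of_norm_le_const (a := 0) (b := s)
      (C := B * M * Real.exp (τ * s))
      (f := fun u : ℝ => f (ρ * (s - u)) * (L.q (1 - u) * L.rightSol (ρ ^ 2) u)) (fun u hu => by
        rw [uIoc_of_le hs.1] at hu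
        have hu1 : u ∈ Icc (0 : ℝ) 1 := ⟨hu.1.le, hu.2.trans hs.2⟩
        have h1 := hf (ρ * (s - u))
        rw [him s u hu.2] at h1
        rw [norm_mul, norm_mul, Complex.norm_real, Real.norm_eq_abs]
        calc _ ≤ Real.exp (τ * (s - u)) * (B * (M * Real.exp (τ * u))) := by
              gcongr
              · exact hB _ (one_sub_mem_Icc hu1)
              · exact hz u hu1
          _ = B * M * (Real.exp (τ * (s - u)) * Real.exp (τ * u)) := by ring
          _ = _ := by rw [← Real.exp_add]; ring_nf)
    refine this.trans ?_
    rw [sub_zero, abs_of_nonneg hs.1]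
    exact mul_le_of_le_one_right (by positivity) hs.2
  have hsin : ∀ s ∈ Icc (0 : ℝ) 1, ‖Complex.sin (ρ * s)‖ ≤ Real.exp (τ * s) := by
    intro s hs
    have := norm_sin_le_exp (ρ * s)
    rwa [Complex.im_mul_ofReal, abs_mul, abs_of_nonneg hs.1] at this
  have hMle : M ≤ 2 / ‖ρ‖ := by
    have h1 := hI s0 hs0 _ norm_sin_le_exp
    rw [← rightSol_integral hq ρ hs0] at h1
    have h2 : ‖ρ‖ * ‖L.rightSol (ρ ^ 2) s0‖ ≤ (1 + B * M) * Real.exp (τ * s0) := by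
      rw [← norm_mul]
      have h3 := norm_sub_norm_le (ρ * L.rightSol (ρ ^ 2) s0) (Complex.sin (ρ * s0))
      have h4 := hsin s0 hs0
      linarith
    have h5 : ‖ρ‖ * M ≤ 1 + B * M := by
      calc ‖ρ‖ * M = Real.exp (-(τ * s0)) * (‖ρ‖ * ‖L.rightSol (ρ ^ 2) s0‖) := by rw [hM]; ring
        _ ≤ Real.exp (-(τ * s0)) * ((1 + B * M) * Real.exp (τ * s0)) := by gcongr
        _ = _ := by rw [Real.exp_neg]; field_simp
    rw [le_div_iff₀ hρ]
    nlinarith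
  refine ⟨(hz s hs).trans (by gcongr), ?_⟩
  rw [rightSolDeriv_integral hq ρ hs]
  calc _ ≤ B * M * Real.exp (τ * s) := hI s hs _ norm_cos_le_exp
    _ ≤ B * (2 / ‖ρ‖) * Real.exp (τ * s) := by gcongr
    _ = _ := by ring

theorem norm_charFun_add_cos_le (hq : ContinuousOn L.q (Icc 0 1)) (h0 : 0 < L.ξ) (h1 : L.ξ < 1)
    {B : ℝ} (hB : ∀ x ∈ Icc (0 : ℝ) 1, |L.q x| ≤ B) {ρ : ℂ} (hρ : 0 < ‖ρ‖) (hρB : 2 * B ≤ ‖ρ‖) :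
    ‖L.charFun (ρ ^ 2) + Complex.cos ρ‖
      ≤ 2 * (B + |L.h| + |L.γ|) / ‖ρ‖ * Real.exp |ρ.im| := by
  have hξ : (L.ξ : ℝ) ∈ Icc (0 : ℝ) 1 := ⟨by exact_mod_cast h0.le, by exact_mod_cast h1.le⟩
  have h1m : (1 : ℝ) ∈ Icc (0 : ℝ) 1 := right_mem_Icc.2 zero_le_one
  obtain ⟨e1, e2⟩ := norm_rightSol_estimates hq hB hρ hρB h1m
  obtain ⟨e3, -⟩ := norm_rightSol_estimates hq hB hρ hρB (one_sub_mem_Icc hξ)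
  have e3' : ‖L.rightSol (ρ ^ 2) (1 - (L.ξ : ℝ))‖ ≤ 2 / ‖ρ‖ * Real.exp |ρ.im| := by
    refine e3.trans ?_
    gcongr
    exact mul_le_of_le_one_right (abs_nonneg _) (one_sub_mem_Icc hξ).2
  simp only [Complex.ofReal_one, mul_one] at e1 e2
  rw [charFun_eq_rightSol hq]
  have h : -L.rightSolDeriv (ρ ^ 2) 1 + L.h * L.rightSol (ρ ^ 2) 1
      - L.γ * L.rightSol (ρ ^ 2) (1 - (L.ξ : ℝ)) + Complex.cos ρ =
      -(L.rightSolDeriv (ρ ^ 2) 1 - Complex.cos ρ) + L.h * L.rightSol (ρ ^ 2) 1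
      - L.γ * L.rightSol (ρ ^ 2) (1 - (L.ξ : ℝ)) := by ring
  rw [h]
  calc _ ≤ ‖L.rightSolDeriv (ρ ^ 2) 1 - Complex.cos ρ‖ + |L.h| * ‖L.rightSol (ρ ^ 2) 1‖
        + |L.γ| * ‖L.rightSol (ρ ^ 2) (1 - (L.ξ : ℝ))‖ := by
        refine (norm_sub_le _ _).trans ?_
        rw [norm_mul, Complex.norm_real, Real.norm_eq_abs]
        gcongr
        refine (norm_add_le _ _).trans ?_
        rw [norm_neg, norm_mul, Complex.norm_real, Real.norm_eq_abs]
    _ ≤ 2 * B / ‖ρ‖ * Real.exp |ρ.im| + |L.h| * (2 / ‖ρ‖ * Real.exp |ρ.im|)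
        + |L.γ| * (2 / ‖ρ‖ * Real.exp |ρ.im|) := by gcongr
    _ = _ := by ring

/-! ### The free problem and the location of the eigenvalues -/

/-- The problem with `q = 0`, `h = 0`, `γ = 0`; its characteristic function is `-cos √k`. -/
def free : NonlocalBVP := ⟨0, 0, 0, 1 / 2⟩

theorem continuousOn_free : ContinuousOn free.q (Icc 0 1) :=
  continuousOn_const (c := (0 : ℝ))

theorem charFun_free (ρ : ℂ) : free.charFun (ρ ^ 2) = -Complex.cos ρ := by
  have h := rightSolDeriv_integral continuousOn_free ρ (right_mem_Icc.2 zero_le_one)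
  simp [free] at h
  rw [charFun_eq_rightSol continuousOn_free]
  simp [free]
  linear_combination h

theorem differentiable_charFun_free : Differentiable ℂ free.charFun :=
  differentiable_charFun continuousOn_free (by norm_num [free]) (by norm_num [free])

/-- The number `(n + 1/2) π`. -/
noncomputable def nu (n : ℕ) : ℝ := (n + 1 / 2) * Real.pi

theorem nu_pos (n : ℕ) : 0 < nu n := by
  have := Real.pi_pos
  unfold nu; positivity

theorem cos_nu (n : ℕ) : Real.cos (nu n) = 0 := by
  rw [Real.cos_eq_zero_iff]
  exact ⟨n, by unfold nu; push_cast; ring⟩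

theorem sin_nu (n : ℕ) : Real.sin (nu n) = (-1) ^ n := by
  rw [nu, show ((n : ℝ) + 1 / 2) * Real.pi = Real.pi / 2 + n * Real.pi by ring,
    Real.sin_add_nat_mul_pi, Real.sin_pi_div_two, mul_one]

theorem nu_injective : Function.Injective nu := by
  intro m n h
  have h2 : (m : ℝ) + 1 / 2 = n + 1 / 2 := mul_right_cancel₀ Real.pi_ne_zero h
  exact_mod_cast add_right_cancel h2

/-- Simplicity comes from the chain rule: differentiating Δ(ρ²) = -cos ρ gives Δ'(ρ²)·2ρ = sin ρ,
which cannot vanish together with cos ρ. -/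
theorem enumeratesZeros_free :
    EnumeratesZeros free.charFun (fun n => ((nu n : ℝ) : ℂ) ^ 2) := by
  have hzero : ∀ n, free.charFun (((nu n : ℝ) : ℂ) ^ 2) = 0 := fun n => by
    rw [charFun_free, ← Complex.ofReal_cos, cos_nu]; simp
  have hinj : ∀ m n, ((nu m : ℝ) : ℂ) ^ 2 = ((nu n : ℝ) : ℂ) ^ 2 → m = n := by
    intro m n h
    have h1 : nu m ^ 2 = nu n ^ 2 := by exact_mod_cast h
    exact nu_injective ((sq_eq_sq₀ (nu_pos m).le (nu_pos n).le).1 h1)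
  intro μ
  by_cases hμ : free.charFun μ = 0
  · obtain ⟨ρ, rfl⟩ : ∃ ρ : ℂ, μ = ρ ^ 2 := by
      obtain ⟨ρ, hρ⟩ := IsAlgClosed.exists_pow_nat_eq μ (n := 2) (by norm_num)
      exact ⟨ρ, hρ.symm⟩
    rw [charFun_free, neg_eq_zero] at hμ
    have hn : ∃ n, ((nu n : ℝ) : ℂ) ^ 2 = ρ ^ 2 := by
      obtain ⟨j, hj⟩ := Complex.cos_eq_zero_iff.1 hμ
      -- A negative integer -(n + 1) yields ρ = -(n + 1/2)π, which has the same square.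
      rcases j with n | n
      · refine ⟨n, ?_⟩
        rw [hj, nu, Int.ofNat_eq_natCast]; push_cast; ring
      · refine ⟨n, ?_⟩
        rw [hj, nu]; push_cast; ring
    obtain ⟨n, hn⟩ := hn
    have hset : {m | ((nu m : ℝ) : ℂ) ^ 2 = ρ ^ 2} = {n} := by
      ext m
      simp only [mem_ofPred_eq, mem_singleton_iff]
      exact ⟨fun h => hinj m n (h.trans hn.symm), fun h => h ▸ hn⟩
    have hd : deriv free.charFun (ρ ^ 2) ≠ 0 := by
      intro hd0
      have h1 := (differentiable_charFun_free (ρ ^ 2)).hasDerivAt.comp ρ (hasDerivAt_pow 2 ρ)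
      have h2 : HasDerivAt (free.charFun ∘ fun ρ => ρ ^ 2) (Complex.sin ρ) ρ := by
        have : (free.charFun ∘ fun ρ => ρ ^ 2) = fun ρ => -Complex.cos ρ :=
          funext fun ρ => charFun_free ρ
        rw [this]
        simpa using (Complex.hasDerivAt_cos ρ).fun_neg
      have h3 := h1.unique h2
      rw [hd0, zero_mul] at h3
      have h4 := Complex.sin_sq_add_cos_sq ρ
      rw [← h3, hμ] at h4
      simp at h4
    rw [hset, encard_singleton,
      (differentiable_charFun_free.analyticAt _).analyticOrderAt_eq_one_of_zero_deriv_ne_zero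
        (by rw [charFun_free, hμ, neg_zero]) hd]
  · rw [(differentiable_charFun_free.analyticAt μ).analyticOrderAt_eq_zero.2 hμ, encard_eq_zero]
    ext n
    simp only [mem_ofPred_eq, mem_empty_iff_false, iff_false]
    rintro rfl
    exact hμ (hzero n)

theorem Admissible.continuousOn (hL : L.Admissible) : ContinuousOn L.q (Icc 0 1) :=
  hL.contDiffOn.continuousOn

theorem Admissible.ξ_mem (hL : L.Admissible) : (L.ξ : ℝ) ∈ Ioo (0 : ℝ) 1 :=
  ⟨by exact_mod_cast hL.ξ_pos, by exact_mod_cast hL.ξ_lt_one⟩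

theorem Admissible.differentiable_charFun (hL : L.Admissible) : Differentiable ℂ L.charFun :=
  NonlocalBVP.differentiable_charFun hL.continuousOn hL.ξ_pos hL.ξ_lt_one

theorem IsEigenvalueSeq.charFun_eq_zero {lam : ℕ → ℂ} (hlam : L.IsEigenvalueSeq lam) (n : ℕ) :
    L.charFun (lam n) = 0 :=
  EnumeratesZeros.apply_eq_zero (f := L.charFun) hlam.2 n

theorem Admissible.exists_charFun_bound (hL : L.Admissible) : ∃ K : ℝ, 0 < K ∧ ∀ ρ : ℂ,
    K ≤ ‖ρ‖ → ‖L.charFun (ρ ^ 2) + Complex.cos ρ‖ ≤ K / ‖ρ‖ * Real.exp |ρ.im| := by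
  obtain ⟨B, hB⟩ := isCompact_Icc.exists_bound_of_continuousOn hL.continuousOn
  have hB0 : 0 ≤ B := (norm_nonneg _).trans (hB 0 (left_mem_Icc.2 zero_le_one))
  refine ⟨2 * (B + |L.h| + |L.γ|) + 1, by positivity, fun ρ hρ => ?_⟩
  have h1 := abs_nonneg L.h
  have h2 := abs_nonneg L.γ
  have hρ0 : 0 < ‖ρ‖ := by linarith
  refine (norm_charFun_add_cos_le hL.continuousOn hL.ξ_pos hL.ξ_lt_one hB hρ0
    (by linarith)).trans ?_
  gcongr
  linarith

/-- For large `N` exactly the first `N` eigenvalues lie in the disc of radius `(N π)²`. -/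
theorem IsEigenvalueSeq.eventually_norm_lt_iff (hL : L.Admissible) {lam : ℕ → ℂ}
    (hlam : L.IsEigenvalueSeq lam) :
    ∀ᶠ N : ℕ in atTop, ∀ n, ‖lam n‖ < (N * Real.pi) ^ 2 ↔ n < N := by
  obtain ⟨K, hK0, hK⟩ := hL.exists_charFun_bound
  filter_upwards [eventually_ge_atTop 1, eventually_ge_atTop ⌈4 * K + 1⌉₊] with N hN1 hN
  have hpi := Real.pi_gt_three
  have hN1' : (1 : ℝ) ≤ N := by exact_mod_cast hN1
  have hNK : 4 * K + 1 ≤ (N : ℝ) := (Nat.le_ceil _).trans (by exact_mod_cast hN)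
  -- Makes K/|ρ| < 1/4 on the circle, against the constant 1/4 in `exp_div_four_le_norm_cos`.
  have hNpi : 4 * K < N * Real.pi := by nlinarith
  have hR : 0 < (N * Real.pi) ^ 2 := by positivity
  have hcount : {n | ‖lam n‖ < (N * Real.pi) ^ 2}.ncard = N := by
    rw [EnumeratesZeros.ncard_eq (f := L.charFun) hlam.2 enumeratesZeros_free
      hL.differentiable_charFun differentiable_charFun_free hR]
    · have : {n | ‖((nu n : ℝ) : ℂ) ^ 2‖ < (N * Real.pi) ^ 2} = ↑(Finset.range N) := by
        ext n
        simp only [mem_ofPred_eq, Finset.coe_range, mem_Iio]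
        rw [norm_pow, Complex.norm_real, Real.norm_of_nonneg (nu_pos n).le,
          sq_lt_sq₀ (nu_pos n).le (by positivity), nu, mul_lt_mul_iff_left₀ Real.pi_pos]
        constructor
        · intro h
          have : (n : ℝ) < N := by linarith
          exact_mod_cast this
        · intro h
          have : (n : ℝ) + 1 ≤ N := by exact_mod_cast h
          linarith
      rw [this, ncard_coe_finset, Finset.card_range]
    · intro μ hμ
      obtain ⟨ρ, rfl⟩ : ∃ ρ : ℂ, μ = ρ ^ 2 := by
        obtain ⟨ρ, hρ⟩ := IsAlgClosed.exists_pow_nat_eq μ (n := 2) (by norm_num)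
        exact ⟨ρ, hρ.symm⟩
      have hρ : ‖ρ‖ = N * Real.pi := by
        rw [mem_sphere_zero_iff_norm, norm_pow] at hμ
        exact (sq_eq_sq₀ (norm_nonneg _) (by positivity)).1 hμ
      rw [charFun_free, sub_neg_eq_add, norm_neg]
      refine (hK ρ (by rw [hρ]; linarith)).trans_lt
        (lt_of_lt_of_le ?_ (exp_div_four_le_norm_cos hN1 hρ))
      rw [div_eq_mul_inv (Real.exp _), mul_comm (Real.exp _)]
      gcongr
      rw [hρ, div_lt_iff₀ (by positivity)]
      linarith
  have hfin : {n | ‖lam n‖ < (N * Real.pi) ^ 2}.Finite :=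
    finite_of_ncard_ne_zero (by rw [hcount]; omega)
  -- As moduli are non-decreasing, the N indices in the disc form an initial segment.
  have hsub : {n | ‖lam n‖ < (N * Real.pi) ^ 2} ⊆ ↑(Finset.range N) := by
    intro n hn
    have h1 : ↑(Finset.range (n + 1)) ⊆ {n | ‖lam n‖ < (N * Real.pi) ^ 2} := by
      intro m hm
      simp only [Finset.coe_range, mem_Iio] at hm
      exact lt_of_le_of_lt (hlam.1 (Nat.lt_succ_iff.1 hm)) hn
    have h2 := ncard_le_ncard h1 hfin
    rw [ncard_coe_finset, Finset.card_range, hcount] at h2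
    simp only [Finset.coe_range, mem_Iio]
    omega
  have heq := eq_of_subset_of_ncard_le hsub (by rw [ncard_coe_finset, Finset.card_range, hcount])
    (Finset.finite_toSet _)
  intro n
  have := Set.ext_iff.1 heq n
  simpa using this

/-- For large `n` the `n`-th eigenvalue is real and positive, and its square root lies in
`[n π, (n + 1) π)` close to `(n + 1/2) π`. -/
theorem IsEigenvalueSeq.eventually_exists_sqrt (hL : L.Admissible) {lam : ℕ → ℂ}
    (hlam : L.IsEigenvalueSeq lam) :
    ∃ K : ℝ, 0 < K ∧ ∀ᶠ n : ℕ in atTop, ∃ ρ : ℝ, 0 < ρ ∧ lam n = (ρ : ℂ) ^ 2 ∧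
      |ρ - nu n| ≤ K / nu n := by
  obtain ⟨K, hK0, hK⟩ := hL.exists_charFun_bound
  have hev := hlam.eventually_norm_lt_iff hL
  refine ⟨4 * K, by positivity, ?_⟩
  filter_upwards [hev, (tendsto_add_atTop_nat 1).eventually hev, eventually_ge_atTop 1,
    eventually_ge_atTop ⌈2 * K + 1⌉₊] with n h1 h2 hn1 hnK
  have hpi := Real.pi_gt_three
  have hn1' : (1 : ℝ) ≤ n := by exact_mod_cast hn1
  have hnK' : 2 * K + 1 ≤ (n : ℝ) := (Nat.le_ceil _).trans (by exact_mod_cast hnK)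
  have hlow : (n * Real.pi) ^ 2 ≤ ‖lam n‖ := not_lt.1 fun h => lt_irrefl n ((h1 n).1 h)
  have hupp : ‖lam n‖ < ((n + 1 : ℕ) * Real.pi) ^ 2 := (h2 n).2 (by omega)
  -- The conjugate is an eigenvalue in the same annulus, which contains only the one with index n.
  have hreal : starRingEnd ℂ (lam n) = lam n := by
    have h0 : L.charFun (starRingEnd ℂ (lam n)) = 0 := by
      rw [charFun_conj hL.continuousOn hL.ξ_pos hL.ξ_lt_one, hlam.charFun_eq_zero, map_zero]
    obtain ⟨m, hm⟩ := EnumeratesZeros.exists_eq (f := L.charFun) hlam.2 hL.differentiable_charFun h0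
    have hmn : ‖lam m‖ = ‖lam n‖ := by rw [hm, RCLike.norm_conj]
    have h3 : ¬ m < n := fun h => absurd ((h1 m).2 h) (by rw [hmn]; exact not_lt.2 hlow)
    have h4 : m < n + 1 := (h2 m).1 (by rw [hmn]; exact hupp)
    have : m = n := by omega
    rw [← hm, this]
  obtain ⟨x, hx⟩ := Complex.conj_eq_iff_real.1 hreal
  have hnorm : ‖lam n‖ = |x| := by rw [hx, Complex.norm_real, Real.norm_eq_abs]
  have hKρ : ∀ ρ : ℂ, ρ ^ 2 = lam n → ‖Complex.cos ρ‖ ≤ K / ‖ρ‖ * Real.exp |ρ.im| ∧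
      n * Real.pi ≤ ‖ρ‖ ∧ ‖ρ‖ < (n + 1) * Real.pi := by
    intro ρ hρ
    have h3 : n * Real.pi ≤ ‖ρ‖ := by
      rw [← hρ, norm_pow] at hlow
      exact (sq_le_sq₀ (by positivity) (norm_nonneg _)).1 hlow
    refine ⟨?_, h3, ?_⟩
    · have := hK ρ (by nlinarith)
      rwa [hρ, hlam.charFun_eq_zero, zero_add] at this
    · rw [← hρ, norm_pow] at hupp
      have := (sq_lt_sq₀ (norm_nonneg _) (by positivity)).1 hupp
      push_cast at this
      exact this
  -- For a negative eigenvalue -t² the equation would force cosh t ≤ (K/t)eᵗ with K/t < 1/2,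
  -- contradicting cosh t > eᵗ/2.
  have hxpos : 0 < x := by
    by_contra hneg
    push Not at hneg
    have hsq : (Complex.I * (Real.sqrt (-x) : ℝ)) ^ 2 = lam n := by
      rw [mul_pow, Complex.I_sq, ← Complex.ofReal_pow, Real.sq_sqrt (by linarith), hx]
      push_cast; ring
    obtain ⟨h3, h4, -⟩ := hKρ _ hsq
    have hN : ‖Complex.I * (Real.sqrt (-x) : ℝ)‖ = Real.sqrt (-x) := by
      rw [norm_mul, Complex.norm_I, one_mul, Complex.norm_real,
        Real.norm_of_nonneg (Real.sqrt_nonneg _)]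
    have him : (Complex.I * (Real.sqrt (-x) : ℝ)).im = Real.sqrt (-x) := by simp
    rw [hN] at h4
    rw [hN, him, abs_of_nonneg (Real.sqrt_nonneg _), mul_comm Complex.I, Complex.cos_mul_I,
      ← Complex.ofReal_cosh, Complex.norm_real, Real.norm_of_nonneg (Real.cosh_pos _).le,
      Real.cosh_eq] at h3
    have h5 : K / Real.sqrt (-x) < 1 / 2 := by
      rw [div_lt_iff₀ (by nlinarith)]
      nlinarith
    have h6 := Real.exp_pos (Real.sqrt (-x))
    have h7 := Real.exp_pos (-Real.sqrt (-x))
    nlinarith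
  refine ⟨Real.sqrt x, Real.sqrt_pos.2 hxpos, ?_, ?_⟩
  · rw [← Complex.ofReal_pow, Real.sq_sqrt hxpos.le, hx]
  · obtain ⟨h3, h4, h5⟩ := hKρ (Real.sqrt x : ℝ) (by
      rw [← Complex.ofReal_pow, Real.sq_sqrt hxpos.le, hx])
    set ρ := Real.sqrt x with hρ
    have hρ0 : 0 < ρ := Real.sqrt_pos.2 hxpos
    rw [Complex.norm_real, Real.norm_of_nonneg hρ0.le] at h4 h5
    rw [← Complex.ofReal_cos, Complex.norm_real, Complex.norm_real, Real.norm_of_nonneg hρ0.le,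
      Complex.ofReal_im, abs_zero, Real.exp_zero, mul_one, Real.norm_eq_abs] at h3
    have h6 : |ρ - nu n| ≤ Real.pi / 2 := by
      rw [abs_le]; unfold nu
      constructor <;> nlinarith
    -- Jordan's inequality: the distance from ρ to ν_n is controlled by |sin(ρ - ν_n)| = |cos ρ|,
    -- which is at most K/ρ.
    have h7 := Real.mul_abs_le_abs_sin h6
    have h8 : |Real.sin (ρ - nu n)| = |Real.cos ρ| := by
      rw [Real.sin_sub, cos_nu, sin_nu, mul_zero, zero_sub, abs_neg, abs_mul, abs_pow, abs_neg,
        abs_one, one_pow, mul_one]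
    rw [h8] at h7
    have h9 : nu n ≤ 2 * ρ := by unfold nu; nlinarith
    have hpi4 := Real.pi_le_four
    have hν := nu_pos n
    have h10 : K / ρ ≤ 2 * K / nu n := by
      rw [div_le_div_iff₀ hρ0 hν]
      nlinarith
    have h11 : 1 / 2 * |ρ - nu n| ≤ 2 / Real.pi * |ρ - nu n| := by
      gcongr ?_ * _
      rw [div_le_div_iff₀ (by norm_num) (by positivity)]
      linarith
    calc |ρ - nu n| ≤ 2 * (2 * K / nu n) := by linarith
      _ = 4 * K / nu n := by ring

end NonlocalBVP

/-! ### Prüfer variables and the asymptotics of the phase -/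

theorem hasDerivWithinAt_integral_of_continuousOn {E : Type*} [NormedAddCommGroup E]
    [NormedSpace ℝ E] [CompleteSpace E] {f : ℝ → E} (hf : ContinuousOn f (Icc 0 1)) {x : ℝ}
    (hx : x ∈ Icc (0 : ℝ) 1) :
    HasDerivWithinAt (fun x => ∫ t in (0 : ℝ)..x, f t) (f x) (Icc 0 1) x := by
  set fe : ℝ → E := IccExtend (zero_le_one' ℝ) ((Icc (0 : ℝ) 1).domRestrict f) with hfe
  have hfec : Continuous fe := (continuousOn_iff_continuous_domRestrict.1 hf).Icc_extend'
  have hfeq : ∀ x ∈ Icc (0 : ℝ) 1, fe x = f x := fun x hx => by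
    rw [hfe, IccExtend_of_mem _ _ hx]; rfl
  have hd : HasDerivAt (fun x => ∫ t in (0 : ℝ)..x, fe t) (fe x) x :=
    intervalIntegral.integral_hasDerivAt_right (hfec.intervalIntegrable _ _)
      (hfec.stronglyMeasurableAtFilter _ _) hfec.continuousAt
  have heq : ∀ y ∈ Icc (0 : ℝ) 1, (∫ t in (0 : ℝ)..y, f t) = ∫ t in (0 : ℝ)..y, fe t := by
    intro y hy
    refine intervalIntegral.integral_congr fun t ht => ?_
    rw [uIcc_of_le hy.1] at ht
    exact (hfeq t ⟨ht.1, ht.2.trans hy.2⟩).symm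
  rw [← hfeq x hx]
  exact hd.hasDerivWithinAt.congr heq (heq x hx)

theorem norm_sub_le_of_hasDerivWithinAt {f f' : ℝ → ℝ} {C : ℝ}
    (hf : ∀ x ∈ Icc (0 : ℝ) 1, HasDerivWithinAt f (f' x) (Icc 0 1) x)
    (hC : ∀ x ∈ Icc (0 : ℝ) 1, |f' x| ≤ C) {x : ℝ} (hx : x ∈ Icc (0 : ℝ) 1) :
    |f x - f 0| ≤ C := by
  have h0 : (0 : ℝ) ∈ Icc (0 : ℝ) 1 := left_mem_Icc.2 zero_le_one
  have hC0 : 0 ≤ C := (abs_nonneg _).trans (hC 0 h0)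
  have := (convex_Icc (0 : ℝ) 1).norm_image_sub_le_of_norm_hasDerivWithin_le hf hC h0 hx
  rw [Real.norm_eq_abs, Real.norm_eq_abs, sub_zero, abs_of_nonneg hx.1] at this
  exact this.trans (mul_le_of_le_one_right hC0 hx.2)

namespace NonlocalBVP

variable {L : NonlocalBVP}

/-- Prüfer variables for `rightSol` at the spectral parameter `ρ²`. -/
structure Prufer (L : NonlocalBVP) (ρ : ℝ) (a θ : ℝ → ℝ) : Prop where
  amp_zero : a 0 = 0
  angle_zero : θ 0 = 0
  hasDeriv_amp : ∀ s ∈ Icc (0 : ℝ) 1,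
    HasDerivWithinAt a (L.q (1 - s) / ρ * (Real.sin (θ s) * Real.cos (θ s))) (Icc 0 1) s
  hasDeriv_angle : ∀ s ∈ Icc (0 : ℝ) 1,
    HasDerivWithinAt θ (ρ - L.q (1 - s) / ρ * Real.sin (θ s) ^ 2) (Icc 0 1) s
  sol_eq : ∀ s ∈ Icc (0 : ℝ) 1,
    L.rightSol ((ρ : ℂ) ^ 2) s = ((Real.exp (a s) * Real.sin (θ s) / ρ : ℝ) : ℂ)
  solDeriv_eq : ∀ s ∈ Icc (0 : ℝ) 1,
    L.rightSolDeriv ((ρ : ℂ) ^ 2) s = ((Real.exp (a s) * Real.cos (θ s) : ℝ) : ℂ)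

/-- The function w = z' + iρz has no zeros and satisfies w' = gw with g = iρ + qz/w, hence w =
exp(∫g). The real and imaginary parts of ∫g serve as a and θ, so no continuous branch of the
argument has to be chosen. -/
theorem exists_prufer (hq : ContinuousOn L.q (Icc 0 1)) {ρ : ℝ} (hρ : 0 < ρ) :
    ∃ a θ : ℝ → ℝ, L.Prufer ρ a θ := by
  set k : ℂ := (ρ : ℂ) ^ 2 with hk
  have hconj : starRingEnd ℂ k = k := by rw [hk, map_pow, Complex.conj_ofReal]
  have hρc : (ρ : ℂ) ≠ 0 := by exact_mod_cast hρ.ne'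
  have hreal : ∀ s ∈ Icc (0 : ℝ) 1, L.rightSol k s = ((L.rightSol k s).re : ℂ) ∧
      L.rightSolDeriv k s = ((L.rightSolDeriv k s).re : ℂ) := by
    intro s hs
    have := rightSol_conj hq k hs
    rw [hconj] at this
    exact ⟨(Complex.conj_eq_iff_re.1 this.1.symm).symm, (Complex.conj_eq_iff_re.1 this.2.symm).symm⟩
  set z : ℝ → ℝ := fun s => (L.rightSol k s).re with hz
  set z' : ℝ → ℝ := fun s => (L.rightSolDeriv k s).re with hz'
  set w : ℝ → ℂ := fun s => L.rightSolDeriv k s + Complex.I * ρ * L.rightSol k s with hw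
  have hwz : ∀ s ∈ Icc (0 : ℝ) 1, w s = ⟨z' s, ρ * z s⟩ := by
    intro s hs
    obtain ⟨h1, h2⟩ := hreal s hs
    simp only [hw]
    rw [h1, h2]
    apply Complex.ext <;> simp [hz, hz']
  have hw0 : ∀ s ∈ Icc (0 : ℝ) 1, w s ≠ 0 := by
    intro s hs h0
    rw [hwz s hs] at h0
    obtain ⟨h1, h2⟩ := hreal s hs
    have hre : z' s = 0 := congrArg Complex.re h0
    have him : ρ * z s = 0 := congrArg Complex.im h0
    have hz0 : z s = 0 := (mul_eq_zero.1 him).resolve_left hρ.ne'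
    refine rightSolDeriv_ne_zero hq hs (k := k) ?_ ?_
    · rw [h1]; exact_mod_cast hz0
    · rw [h2]; exact_mod_cast hre
  have hQ : ContinuousOn (fun s => (L.q (1 - s) : ℂ)) (Icc 0 1) :=
    Complex.continuous_ofReal.comp_continuousOn (continuousOn_potential hq)
  have hzc := continuousOn_rightSol hq k
  have hzc' := continuousOn_rightSolDeriv hq k
  have hwc : ContinuousOn w (Icc 0 1) := by fun_prop
  set g : ℝ → ℂ := fun s => Complex.I * ρ + L.q (1 - s) * (L.rightSol k s / w s) with hg
  have hgc : ContinuousOn g (Icc 0 1) :=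
    continuousOn_const.add (hQ.mul (hzc.div hwc hw0))
  set E : ℝ → ℂ := fun s => ∫ u in (0 : ℝ)..s, g u with hE
  have hEd : ∀ s ∈ Icc (0 : ℝ) 1, HasDerivWithinAt E (g s) (Icc 0 1) s := fun s hs =>
    hasDerivWithinAt_integral_of_continuousOn hgc hs
  have hE0 : E 0 = 0 := by simp [hE]
  have hwd : ∀ s ∈ Icc (0 : ℝ) 1, HasDerivWithinAt w (g s * w s) (Icc 0 1) s := by
    intro s hs
    obtain ⟨h1, h2⟩ := hasDerivWithinAt_rightSol hq k hs
    refine (h2.add (h1.const_mul (Complex.I * ρ))).congr_deriv ?_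
    simp only [hg]
    rw [add_mul, mul_assoc (L.q (1 - s) : ℂ), div_mul_cancel₀ _ (hw0 s hs)]
    simp only [hw]
    rw [hk]
    linear_combination (-(ρ : ℂ) ^ 2 * L.rightSol (↑ρ ^ 2) s) * Complex.I_sq
  have hwE : ∀ s ∈ Icc (0 : ℝ) 1, w s = Complex.exp (E s) := by
    intro s hs
    have h0m : (0 : ℝ) ∈ Icc (0 : ℝ) 1 := left_mem_Icc.2 zero_le_one
    have := eq_of_hasDerivWithinAt_zero (f := fun s => w s * Complex.exp (-E s)) (fun x hx => by
      have := (hwd x hx).mul ((hEd x hx).neg.cexp)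
      refine this.congr_deriv ?_
      simp only [Pi.neg_apply]
      ring) hs h0m
    have hw1 : w 0 = 1 := by simp [hw, rightSolDeriv_zero hq, rightSol_zero]
    simp only [hE0, hw1, neg_zero, Complex.exp_zero, mul_one] at this
    rw [Complex.exp_neg] at this
    field_simp at this
    exact this
  have hparts : ∀ s ∈ Icc (0 : ℝ) 1,
      z' s = Real.exp (E s).re * Real.cos (E s).im ∧
      ρ * z s = Real.exp (E s).re * Real.sin (E s).im := by
    intro s hs
    have h1 := hwE s hs
    rw [hwz s hs] at h1
    constructor
    · have := congrArg Complex.re h1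
      rwa [Complex.exp_re] at this
    · have := congrArg Complex.im h1
      rwa [Complex.exp_im] at this
  have hzs : ∀ s ∈ Icc (0 : ℝ) 1, z s = Real.exp (E s).re * Real.sin (E s).im / ρ := by
    intro s hs
    rw [eq_div_iff hρ.ne', mul_comm]
    exact (hparts s hs).2
  -- This is z/w = (sin θ/ρ)e^{-iθ}.
  have hquot : ∀ s ∈ Icc (0 : ℝ) 1, L.rightSol k s / w s =
      ((Real.sin (E s).im * Real.cos (E s).im / ρ : ℝ) : ℂ) +
        ((-(Real.sin (E s).im ^ 2 / ρ) : ℝ) : ℂ) * Complex.I := by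
    intro s hs
    rw [div_eq_iff (hw0 s hs), (hreal s hs).1, hwz s hs]
    obtain ⟨h1, h2⟩ := hparts s hs
    have h3 : (L.rightSol k s).re = Real.exp (E s).re * Real.sin (E s).im / ρ := hzs s hs
    rw [h1, h2, h3]
    have h4 := Real.sin_sq_add_cos_sq (E s).im
    apply Complex.ext
    · simp only [Complex.ofReal_re, Complex.mul_re, Complex.add_re, Complex.add_im,
        Complex.ofReal_im, Complex.mul_im, Complex.I_re, Complex.I_im]
      field_simp
      linear_combination -Real.sin (E s).im * h4
    · simp only [Complex.ofReal_re, Complex.mul_re, Complex.add_re, Complex.add_im,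
        Complex.ofReal_im, Complex.mul_im, Complex.I_re, Complex.I_im]
      field_simp
      ring
  refine ⟨fun s => (E s).re, fun s => (E s).im, by simp [hE0], by simp [hE0], fun s hs => ?_,
    fun s hs => ?_, fun s hs => ?_, fun s hs => ?_⟩
  · have h1 := Complex.reCLM.hasFDerivAt.comp_hasDerivWithinAt s (hEd s hs)
    refine h1.congr_deriv ?_
    simp only [hg, Complex.reCLM_apply]
    rw [hquot s hs]
    simp only [Complex.add_re, Complex.mul_im, Complex.mul_re, Complex.I_re, Complex.I_im,
      Complex.ofReal_re, Complex.ofReal_im, Complex.add_im]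
    ring
  · have h1 := Complex.imCLM.hasFDerivAt.comp_hasDerivWithinAt s (hEd s hs)
    refine h1.congr_deriv ?_
    simp only [hg, Complex.imCLM_apply]
    rw [hquot s hs]
    simp only [Complex.add_im, Complex.mul_im, Complex.mul_re, Complex.I_re, Complex.I_im,
      Complex.ofReal_re, Complex.ofReal_im, Complex.add_re]
    ring
  · rw [(hreal s hs).1]
    exact_mod_cast hzs s hs
  · rw [(hreal s hs).2]
    exact_mod_cast (hparts s hs).1

/-- The primitive of `q` vanishing at `0`. -/
noncomputable def prim (L : NonlocalBVP) (x : ℝ) : ℝ := ∫ t in (0 : ℝ)..x, L.q t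

theorem hasDerivWithinAt_prim (hq : ContinuousOn L.q (Icc 0 1)) {x : ℝ} (hx : x ∈ Icc (0 : ℝ) 1) :
    HasDerivWithinAt L.prim (L.q x) (Icc 0 1) x :=
  hasDerivWithinAt_integral_of_continuousOn hq hx

theorem hasDerivWithinAt_comp_one_sub_real {f : ℝ → ℝ} {f' : ℝ} {s : ℝ}
    (hf : HasDerivWithinAt f f' (Icc 0 1) (1 - s)) :
    HasDerivWithinAt (fun s => f (1 - s)) (-f') (Icc 0 1) s := by
  have h1 : HasDerivWithinAt (fun s : ℝ => 1 - s) (-1) (Icc 0 1) s := by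
    simpa using (hasDerivWithinAt_id s (Icc (0 : ℝ) 1)).const_sub 1
  have := hf.scomp s h1 (fun s hs => one_sub_mem_Icc hs)
  refine this.congr_deriv ?_
  simp

theorem Prufer.abs_amp_le {ρ : ℝ} {a θ : ℝ → ℝ} (h : L.Prufer ρ a θ) (hρ : 0 < ρ) {B : ℝ}
    (hB : ∀ x ∈ Icc (0 : ℝ) 1, |L.q x| ≤ B) {s : ℝ} (hs : s ∈ Icc (0 : ℝ) 1) :
    |a s| ≤ B / ρ := by
  have := norm_sub_le_of_hasDerivWithinAt h.hasDeriv_amp (C := B / ρ) (fun x hx => by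
    have h1 := Real.abs_sin_le_one (θ x)
    have h2 := Real.abs_cos_le_one (θ x)
    have h3 := hB _ (one_sub_mem_Icc hx)
    rw [abs_mul, abs_div, abs_of_pos hρ, abs_mul]
    have h4 : |Real.sin (θ x)| * |Real.cos (θ x)| ≤ 1 :=
      mul_le_one₀ h1 (abs_nonneg _) h2
    have h5 : |L.q (1 - x)| / ρ ≤ B / ρ := by gcongr
    exact (mul_le_of_le_one_right (by positivity) h4).trans h5) hs
  rwa [h.amp_zero, sub_zero] at this

/-- Write sin²θ = (1 - cos 2θ)/2. The constant half integrates to P(1 - s)/(2ρ) because P(1) = 0.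
The oscillating half is integrated by parts: subtracting q(1 - s) sin 2θ/(4ρ²) cancels the term of
order 1/ρ in the derivative. The boundedness of q' is needed here. -/
theorem Prufer.abs_angle_sub_le {ρ : ℝ} {a θ : ℝ → ℝ} (h : L.Prufer ρ a θ) (hρ : 1 ≤ ρ)
    (hL : L.Admissible) {B B' : ℝ}
    (hB : ∀ x ∈ Icc (0 : ℝ) 1, |L.q x| ≤ B)
    (hB' : ∀ x ∈ Icc (0 : ℝ) 1, |derivWithin L.q (Icc 0 1) x| ≤ B')
    {s : ℝ} (hs : s ∈ Icc (0 : ℝ) 1) :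
    |θ s - (ρ * s + L.prim (1 - s) / (2 * ρ))| ≤ (B ^ 2 + B' + B) / ρ ^ 2 := by
  have hρ0 : 0 < ρ := by linarith
  have h0m : (0 : ℝ) ∈ Icc (0 : ℝ) 1 := left_mem_Icc.2 zero_le_one
  have hB0 : 0 ≤ B := (abs_nonneg _).trans (hB 0 h0m)
  have hB0' : 0 ≤ B' := (abs_nonneg _).trans (hB' 0 h0m)
  have hqd : ∀ x ∈ Icc (0 : ℝ) 1,
      HasDerivWithinAt L.q (derivWithin L.q (Icc 0 1) x) (Icc 0 1) x := fun x hx =>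
    (hL.contDiffOn.differentiableOn one_ne_zero x hx).hasDerivWithinAt
  set q' := derivWithin L.q (Icc 0 1) with hq'
  have hest := norm_sub_le_of_hasDerivWithinAt
    (f := fun s => θ s - (ρ * s + L.prim (1 - s) / (2 * ρ)) -
      L.q (1 - s) * Real.sin (2 * θ s) / (4 * ρ ^ 2))
    (f' := fun s => (q' (1 - s) * Real.sin (2 * θ s) / 4
      + L.q (1 - s) ^ 2 * Real.cos (2 * θ s) * Real.sin (θ s) ^ 2 / (2 * ρ)) / ρ ^ 2)
    (C := (B' / 4 + B ^ 2 / 2) / ρ ^ 2) (fun s hs => by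
      have h1 := h.hasDeriv_angle s hs
      have h2 := hasDerivWithinAt_comp_one_sub_real
        (hasDerivWithinAt_prim hL.continuousOn (one_sub_mem_Icc hs))
      have h3 := hasDerivWithinAt_comp_one_sub_real (hqd _ (one_sub_mem_Icc hs))
      have h4 := (h1.const_mul 2).sin
      have h5 := ((hasDerivWithinAt_id s (Icc (0 : ℝ) 1)).const_mul ρ).add
        (h2.div_const (2 * ρ))
      refine ((h1.sub h5).sub ((h3.mul h4).div_const (4 * ρ ^ 2))).congr_deriv ?_
      have h6 : Real.sin (θ s) ^ 2 = (1 - Real.cos (2 * θ s)) / 2 := by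
        rw [Real.cos_two_mul, ← Real.sin_sq_add_cos_sq (θ s)]; ring
      rw [h6]
      field_simp
      ring) (fun s hs => by
      have h1 := hB _ (one_sub_mem_Icc hs)
      have h2 := hB' _ (one_sub_mem_Icc hs)
      have h3 := Real.abs_sin_le_one (2 * θ s)
      have h4 := Real.abs_cos_le_one (2 * θ s)
      have h5 := Real.abs_sin_le_one (θ s)
      rw [abs_div, abs_of_pos (by positivity : 0 < ρ ^ 2)]
      gcongr
      refine (abs_add_le _ _).trans ?_
      gcongr
      · rw [abs_div, abs_mul, abs_of_pos (by norm_num : (0 : ℝ) < 4)]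
        gcongr
        exact mul_le_of_le_one_right (abs_nonneg _) h3 |>.trans h2
      · rw [abs_div, abs_mul, abs_mul, abs_pow, abs_pow, abs_of_pos (by positivity : 0 < 2 * ρ)]
        have h6 : |L.q (1 - s)| ^ 2 * |Real.cos (2 * θ s)| * |Real.sin (θ s)| ^ 2 ≤ B ^ 2 := by
          calc _ ≤ B ^ 2 * 1 * 1 ^ 2 := by gcongr
            _ = B ^ 2 := by ring
        exact div_le_div₀ (by positivity) h6 (by norm_num) (by linarith)) hs
  have hP : L.prim 1 = 0 := hL.mean_zero
  simp only [h.angle_zero, sub_zero, hP, mul_zero, Real.sin_zero, zero_div, add_zero] at hest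
  have h7 : |L.q (1 - s) * Real.sin (2 * θ s) / (4 * ρ ^ 2)| ≤ B / 4 / ρ ^ 2 := by
    rw [abs_div, abs_of_pos (by positivity : 0 < 4 * ρ ^ 2), div_div]
    gcongr
    rw [abs_mul]
    exact (mul_le_of_le_one_right (abs_nonneg _) (Real.abs_sin_le_one _)).trans
      (hB _ (one_sub_mem_Icc hs))
  have h8 := abs_sub_abs_le_abs_sub (θ s - (ρ * s + L.prim (1 - s) / (2 * ρ)))
    (L.q (1 - s) * Real.sin (2 * θ s) / (4 * ρ ^ 2))
  calc _ ≤ (B' / 4 + B ^ 2 / 2) / ρ ^ 2 + B / 4 / ρ ^ 2 := by linarith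
    _ = (B' / 4 + B ^ 2 / 2 + B / 4) / ρ ^ 2 := by ring
    _ ≤ _ := by
      refine div_le_div_of_nonneg_right ?_ (by positivity)
      nlinarith [sq_nonneg B]

theorem Prufer.continuousOn_angle {ρ : ℝ} {a θ : ℝ → ℝ} (h : L.Prufer ρ a θ) :
    ContinuousOn θ (Icc 0 1) := fun s hs => (h.hasDeriv_angle s hs).continuousWithinAt

theorem Prufer.strictMonoOn_angle {ρ : ℝ} {a θ : ℝ → ℝ} (h : L.Prufer ρ a θ) (hρ : 1 ≤ ρ) {B : ℝ}
    (hB : ∀ x ∈ Icc (0 : ℝ) 1, |L.q x| ≤ B) (hBρ : B < ρ) : StrictMonoOn θ (Icc 0 1) := by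
  refine strictMonoOn_of_deriv_pos (convex_Icc 0 1) h.continuousOn_angle fun s hs => ?_
  rw [interior_Icc] at hs
  have hs1 := Ioo_subset_Icc_self hs
  rw [((h.hasDeriv_angle s hs1).hasDerivAt (Icc_mem_nhds hs.1 hs.2)).deriv]
  have hρ0 : 0 < ρ := by linarith
  have h1 := (abs_le.1 (hB _ (one_sub_mem_Icc hs1))).2
  have h2 := Real.sin_sq_le_one (θ s)
  have h3 : L.q (1 - s) / ρ * Real.sin (θ s) ^ 2 ≤ |L.q (1 - s)| / ρ := by
    calc _ ≤ |L.q (1 - s)| / ρ * Real.sin (θ s) ^ 2 := by gcongr; exact le_abs_self _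
      _ ≤ _ := mul_le_of_le_one_right (by positivity) h2
  have h4 : |L.q (1 - s)| / ρ ≤ |L.q (1 - s)| := div_le_self (abs_nonneg _) hρ
  have h5 := hB _ (one_sub_mem_Icc hs1)
  linarith

/-! ### Nodes as level points of the phase -/

theorem tendsto_nu : Tendsto nu atTop atTop := by
  unfold nu
  exact (tendsto_atTop_add_const_right _ _ tendsto_natCast_atTop_atTop).atTop_mul_const Real.pi_pos

/-- Prüfer variables at the `n`-th eigenvalue `μ = ρ²`, with their asymptotics. -/
structure AngleData (L : NonlocalBVP) (K : ℝ) (n : ℕ) (μ : ℂ) (ρ : ℝ) (a θ : ℝ → ℝ) : Prop where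
  one_le : 1 ≤ ρ
  eq_sq : μ = (ρ : ℂ) ^ 2
  charFun_eq_zero : L.charFun μ = 0
  abs_sub_le : |ρ - nu n| ≤ K / nu n
  nu_le : nu n ≤ 2 * ρ
  prufer : L.Prufer ρ a θ
  abs_amp_le : ∀ s ∈ Icc (0 : ℝ) 1, |a s| ≤ K / nu n
  abs_angle_le : ∀ s ∈ Icc (0 : ℝ) 1,
    |θ s - (ρ * s + L.prim (1 - s) / (2 * ρ))| ≤ K / nu n ^ 2
  strictMonoOn : StrictMonoOn θ (Icc 0 1)
  abs_angle_one : |θ 1 - nu n| < Real.pi / 2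

theorem IsEigenvalueSeq.eventually_angleData (hL : L.Admissible) {lam : ℕ → ℂ}
    (hlam : L.IsEigenvalueSeq lam) :
    ∃ K : ℝ, 0 < K ∧ ∀ᶠ n : ℕ in atTop, ∃ p : ℝ × (ℝ → ℝ) × (ℝ → ℝ),
      L.AngleData K n (lam n) p.1 p.2.1 p.2.2 := by
  obtain ⟨K₀, hK₀, hev⟩ := hlam.eventually_exists_sqrt hL
  obtain ⟨B, hB⟩ := isCompact_Icc.exists_bound_of_continuousOn hL.continuousOn
  obtain ⟨B', hB'⟩ := isCompact_Icc.exists_bound_of_continuousOn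
    (hL.contDiffOn.continuousOn_derivWithin uniqueDiffOn_Icc_zero_one le_rfl)
  have h0m : (0 : ℝ) ∈ Icc (0 : ℝ) 1 := left_mem_Icc.2 zero_le_one
  have hB0 : 0 ≤ B := (norm_nonneg _).trans (hB 0 h0m)
  have hB0' : 0 ≤ B' := (norm_nonneg _).trans (hB' 0 h0m)
  set K := K₀ + 4 * (B ^ 2 + B' + B) with hKdef
  have hBB : 0 ≤ B ^ 2 := sq_nonneg B
  refine ⟨K, by positivity, ?_⟩
  filter_upwards [hev, tendsto_nu.eventually_ge_atTop (2 * K + 2 * B + 4)] with n hn hν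
  obtain ⟨ρ, hρ0, hlamn, hρν⟩ := hn
  have hν0 := nu_pos n
  have hK0 : 0 < K := by positivity
  have hρν' : |ρ - nu n| ≤ K / nu n := by
    refine hρν.trans ?_
    gcongr
    linarith
  have hKν : K / nu n ≤ 1 / 2 := by
    rw [div_le_div_iff₀ hν0 (by norm_num)]
    linarith
  have hle := (abs_le.1 (hρν'.trans hKν)).1
  have hρ2 : nu n ≤ 2 * ρ := by linarith
  have hρ1 : 1 ≤ ρ := by linarith
  obtain ⟨a, θ, hp⟩ := exists_prufer hL.continuousOn hρ0
  have hangle : ∀ s ∈ Icc (0 : ℝ) 1,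
      |θ s - (ρ * s + L.prim (1 - s) / (2 * ρ))| ≤ K / nu n ^ 2 := by
    intro s hs
    refine (hp.abs_angle_sub_le hρ1 hL hB hB' hs).trans ?_
    rw [div_le_div_iff₀ (by positivity) (by positivity)]
    have h1 : nu n ^ 2 ≤ 4 * ρ ^ 2 := by nlinarith
    calc (B ^ 2 + B' + B) * nu n ^ 2 ≤ (B ^ 2 + B' + B) * (4 * ρ ^ 2) := by gcongr
      _ = 4 * (B ^ 2 + B' + B) * ρ ^ 2 := by ring
      _ ≤ K * ρ ^ 2 := by gcongr; linarith
  refine ⟨(ρ, a, θ), hρ1, hlamn, hlam.charFun_eq_zero n, hρν', hρ2, hp, fun s hs => ?_, hangle,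
    hp.strictMonoOn_angle hρ1 hB (by linarith), ?_⟩
  · refine (hp.abs_amp_le hρ0 hB hs).trans ?_
    rw [div_le_div_iff₀ hρ0 hν0]
    nlinarith
  · have h1 := hangle 1 (right_mem_Icc.2 zero_le_one)
    have hP : L.prim 0 = 0 := by simp [prim]
    simp only [mul_one, sub_self, hP, zero_div, add_zero] at h1
    have h2 : K / nu n ^ 2 ≤ K / nu n := by
      gcongr
      nlinarith
    have h3 := abs_sub_le (θ 1) ρ (nu n)
    have h4 := Real.pi_gt_three
    linarith

namespace AngleData

variable {K : ℝ} {n : ℕ} {μ : ℂ} {ρ : ℝ} {a θ : ℝ → ℝ}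

theorem mem_nodes (h : L.AngleData K n μ ρ a θ) (hq : ContinuousOn L.q (Icc 0 1)) {x : ℝ} :
    x ∈ L.nodes μ ↔ x ∈ Ioo (0 : ℝ) 1 ∧ Real.sin (θ (1 - x)) = 0 := by
  rw [nodes_eq hq h.charFun_eq_zero, mem_ofPred_eq]
  refine and_congr_right fun hx => ?_
  have hρ := h.one_le
  rw [h.eq_sq, h.prufer.sol_eq _ (one_sub_mem_Icc (Ioo_subset_Icc_self hx)),
    Complex.ofReal_eq_zero, div_eq_zero_iff, mul_eq_zero]
  have h1 := Real.exp_ne_zero (a (1 - x))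
  have h2 : ρ ≠ 0 := by linarith
  tauto

theorem nu_sub_and_add_half_pi (n : ℕ) : nu n - Real.pi / 2 = n * Real.pi ∧
    nu n + Real.pi / 2 = (n + 1) * Real.pi := by
  unfold nu; constructor <;> ring

/-- The phase increases strictly from 0 to a value strictly between nπ and (n + 1)π, so inside (0,1)
it can only meet the levels π, ..., nπ. -/
theorem exists_mul_pi (h : L.AngleData K n μ ρ a θ) (hq : ContinuousOn L.q (Icc 0 1)) {x : ℝ}
    (hx : x ∈ L.nodes μ) : ∃ k ∈ Finset.Ioc 0 n, θ (1 - x) = k * Real.pi := by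
  obtain ⟨hx1, hx2⟩ := (h.mem_nodes hq).1 hx
  obtain ⟨j, hj⟩ := Real.sin_eq_zero_iff.1 hx2
  have hx3 := one_sub_mem_Icc (Ioo_subset_Icc_self hx1)
  have h1 := h.strictMonoOn (left_mem_Icc.2 zero_le_one) hx3 (by linarith [hx1.2])
  have h2 := h.strictMonoOn hx3 (right_mem_Icc.2 zero_le_one) (by linarith [hx1.1])
  have h3 := (abs_lt.1 h.abs_angle_one).2
  have h4 := (nu_sub_and_add_half_pi n).2
  rw [h.prufer.angle_zero, ← hj] at h1
  rw [← hj] at h2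
  have hj0 : 0 < j := by
    have := pos_of_mul_pos_left h1 Real.pi_pos.le
    exact_mod_cast this
  have hjn : j < n + 1 := by
    have : (j : ℝ) * Real.pi < (n + 1) * Real.pi := by linarith
    have := lt_of_mul_lt_mul_right this Real.pi_pos.le
    exact_mod_cast this
  lift j to ℕ using hj0.le
  refine ⟨j, ?_, by rw [← hj]; simp⟩
  rw [Finset.mem_Ioc]
  constructor <;> omega

theorem exists_angle_eq (h : L.AngleData K n μ ρ a θ) {m : ℕ} (hm : m ∈ Finset.Ioc 0 n) :
    ∃ s ∈ Ioo (0 : ℝ) 1, θ s = m * Real.pi := by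
  rw [Finset.mem_Ioc] at hm
  have h1 := intermediate_value_Ioo zero_le_one h.prufer.continuousOn_angle
  have h2 := (abs_lt.1 h.abs_angle_one).1
  have h3 := (nu_sub_and_add_half_pi n).1
  have hpi := Real.pi_pos
  have hm0 : (0 : ℝ) < m := by exact_mod_cast hm.1
  have hmn : (m : ℝ) ≤ n := by exact_mod_cast hm.2
  obtain ⟨s, hs, hs'⟩ := h1 (show (m : ℝ) * Real.pi ∈ Ioo (θ 0) (θ 1) from
    ⟨by rw [h.prufer.angle_zero]; positivity, by nlinarith⟩)
  exact ⟨s, hs, hs'⟩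

/-- Reflection x = 1 - s reverses order: the nodes to the left of x are those at the levels mπ with
k < m ≤ n. -/
theorem nodeIndex_eq (h : L.AngleData K n μ ρ a θ) (hq : ContinuousOn L.q (Icc 0 1)) {x : ℝ}
    (hx : x ∈ L.nodes μ) {k : ℕ} (hk : θ (1 - x) = k * Real.pi) :
    L.nodeIndex μ x = n - k := by
  have hσ : ∀ m : ℕ, ∃ s, m ∈ Finset.Ioc 0 n → s ∈ Ioo (0 : ℝ) 1 ∧ θ s = m * Real.pi := by
    intro m
    by_cases hm : m ∈ Finset.Ioc 0 n
    · obtain ⟨s, hs⟩ := h.exists_angle_eq hm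
      exact ⟨s, fun _ => hs⟩
    -- A default value; only levels in `Finset.Ioc 0 n` are ever used.
    · exact ⟨0, fun h => absurd h hm⟩
  choose σ hσ using hσ
  have hpi := Real.pi_pos
  have hxI := Ioo_subset_Icc_self ((h.mem_nodes hq).1 hx).1
  have hsub : ∀ m ∈ Finset.Ioc k n, m ∈ Finset.Ioc 0 n := fun m hm => by
    rw [Finset.mem_Ioc] at hm ⊢; omega
  have hset : L.nodes μ ∩ Iio x = (fun m => 1 - σ m) '' ↑(Finset.Ioc k n) := by
    ext y
    constructor
    · rintro ⟨hy, hyx⟩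
      obtain ⟨m, hm, hmy⟩ := h.exists_mul_pi hq hy
      have hyI := Ioo_subset_Icc_self ((h.mem_nodes hq).1 hy).1
      have h1 : θ (1 - x) < θ (1 - y) := h.strictMonoOn (one_sub_mem_Icc hxI)
        (one_sub_mem_Icc hyI) (by linarith [mem_Iio.1 hyx])
      rw [hk, hmy] at h1
      have h2 : k < m := by exact_mod_cast lt_of_mul_lt_mul_right h1 hpi.le
      refine ⟨m, ?_, ?_⟩
      · rw [Finset.mem_Ioc] at hm
        rw [Finset.mem_coe, Finset.mem_Ioc]
        exact ⟨h2, hm.2⟩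
      · have := h.strictMonoOn.injOn (one_sub_mem_Icc hyI) (Ioo_subset_Icc_self (hσ m hm).1)
          (by rw [hmy, (hσ m hm).2])
        simp only
        linarith
    · rintro ⟨m, hm, rfl⟩
      obtain ⟨h1, h2⟩ := hσ m (hsub m hm)
      refine ⟨(h.mem_nodes hq).2 ⟨⟨by linarith [h1.2], by linarith [h1.1]⟩, ?_⟩, ?_⟩
      · simp only [sub_sub_cancel]
        rw [h2]
        exact Real.sin_nat_mul_pi m
      · have h3 : θ (1 - x) < θ (σ m) := by
          rw [hk, h2]
          rw [Finset.mem_coe, Finset.mem_Ioc] at hm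
          have : (k : ℝ) < m := by exact_mod_cast hm.1
          nlinarith
        have := (h.strictMonoOn.lt_iff_lt (one_sub_mem_Icc hxI) (Ioo_subset_Icc_self h1)).1 h3
        simp only [mem_Iio]
        linarith
  rw [nodeIndex, hset, InjOn.ncard_image, ncard_coe_finset, Nat.card_Ioc]
  intro i hi j hj hij
  have h1 : σ i = σ j := by simpa using hij
  have h2 := (hσ i (hsub i hi)).2
  rw [h1, (hσ j (hsub j hj)).2] at h2
  exact_mod_cast (mul_right_cancel₀ hpi.ne' h2).symm

/-- The characteristic equation in Prüfer variables. -/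
theorem charEq (h : L.AngleData K n μ ρ a θ) (hL : L.Admissible) :
    ρ * Real.cos (θ 1) = L.h * Real.sin (θ 1) -
      L.γ * (Real.exp (a (1 - L.ξ) - a 1) * Real.sin (θ (1 - L.ξ))) := by
  have h1m : (1 : ℝ) ∈ Icc (0 : ℝ) 1 := right_mem_Icc.2 zero_le_one
  have h0 := h.charFun_eq_zero
  have hρ : ρ ≠ 0 := by have := h.one_le; linarith
  rw [charFun_eq_rightSol hL.continuousOn, h.eq_sq, h.prufer.sol_eq _ h1m,
    h.prufer.solDeriv_eq _ h1m,
    h.prufer.sol_eq _ (one_sub_mem_Icc (Ioo_subset_Icc_self hL.ξ_mem))] at h0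
  have h1 : -(Real.exp (a 1) * Real.cos (θ 1)) + L.h * (Real.exp (a 1) * Real.sin (θ 1) / ρ)
      - L.γ * (Real.exp (a (1 - L.ξ)) * Real.sin (θ (1 - L.ξ)) / ρ) = 0 := by
    exact_mod_cast h0
  have he := Real.exp_ne_zero (a 1)
  rw [Real.exp_sub]
  field_simp at h1 ⊢
  linear_combination -h1

end AngleData

/-! ### Asymptotics of eigenvalues and nodes, and density -/

/-- The coefficient of `1 / ν` in the asymptotics of the square root of the `n`-th eigenvalue. -/
noncomputable def coefA (L : NonlocalBVP) (n : ℕ) : ℝ := L.γ * Real.cos (nu n * L.ξ) - L.h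

theorem tendsto_const_div_nu (C : ℝ) : Tendsto (fun n => C / nu n) atTop (𝓝 0) :=
  tendsto_nu.const_div_atTop C

theorem tendsto_zero_of_abs_le_div_nu {f : ℕ → ℝ} (C : ℝ) (h : ∀ᶠ n in atTop, |f n| ≤ C / nu n) :
    Tendsto f atTop (𝓝 0) :=
  squeeze_zero_norm' h (tendsto_const_div_nu C)

theorem div_nu_sq_le {C : ℝ} (hC : 0 ≤ C) {n : ℕ} (hn : 1 ≤ nu n) : C / nu n ^ 2 ≤ C / nu n := by
  have := nu_pos n
  gcongr
  nlinarith

/-- Asymptotics of the square roots of the eigenvalues. -/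
theorem tendsto_nu_mul_sub {K : ℝ} (hK : 0 < K) {lam : ℕ → ℂ} (hL : L.Admissible) {ρ : ℕ → ℝ}
    {a θ : ℕ → ℝ → ℝ} (h : ∀ᶠ n in atTop, L.AngleData K n (lam n) (ρ n) (a n) (θ n)) :
    Tendsto (fun n => nu n * (ρ n - nu n) - L.coefA n) atTop (𝓝 0) := by
  have h1m : (1 : ℝ) ∈ Icc (0 : ℝ) 1 := right_mem_Icc.2 zero_le_one
  have hξm := one_sub_mem_Icc (Ioo_subset_Icc_self hL.ξ_mem)
  have hν1 := tendsto_nu.eventually_ge_atTop 1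
  have hP0 : L.prim 0 = 0 := by simp [prim]
  have hdρ : Tendsto (fun n => ρ n - nu n) atTop (𝓝 0) :=
    tendsto_zero_of_abs_le_div_nu K (h.mono fun n hn => hn.abs_sub_le)
  have hamp : ∀ s ∈ Icc (0 : ℝ) 1, Tendsto (fun n => a n s) atTop (𝓝 0) := fun s hs =>
    tendsto_zero_of_abs_le_div_nu K (h.mono fun n hn => hn.abs_amp_le s hs)
  set δ : ℕ → ℝ := fun n => θ n 1 - nu n with hδdef
  set η : ℕ → ℝ := fun n => θ n (1 - L.ξ) - nu n * (1 - L.ξ) with hηdef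
  have hθρ : ∀ᶠ n in atTop, |θ n 1 - ρ n| ≤ K / nu n ^ 2 := h.mono fun n hn => by
    have := hn.abs_angle_le 1 h1m
    simpa [hP0] using this
  have hδb : ∀ᶠ n in atTop, |δ n| ≤ 2 * K / nu n := by
    filter_upwards [h, hν1, hθρ] with n hn hν hθ
    have h2 := div_nu_sq_le hK.le hν
    have h3 := abs_sub_le (θ n 1) (ρ n) (nu n)
    have h4 := hn.abs_sub_le
    calc |δ n| ≤ K / nu n + K / nu n := by simp only [hδdef]; linarith
      _ = _ := by ring
  have hδ : Tendsto δ atTop (𝓝 0) := tendsto_zero_of_abs_le_div_nu _ hδb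
  have hη : Tendsto η atTop (𝓝 0) := by
    refine tendsto_zero_of_abs_le_div_nu (K + K + |L.prim L.ξ|) ?_
    filter_upwards [h, hν1] with n hn hν
    have h1 := hn.abs_angle_le _ hξm
    have h2 := div_nu_sq_le hK.le hν
    have h3 := hn.abs_sub_le
    have hρ1 := hn.one_le
    have hνρ := hn.nu_le
    rw [sub_sub_cancel] at h1
    have h4 : |L.prim L.ξ / (2 * ρ n)| ≤ |L.prim L.ξ| / nu n := by
      rw [abs_div, abs_of_pos (by linarith : 0 < 2 * ρ n)]
      gcongr
    have h5 : |(ρ n - nu n) * (1 - L.ξ)| ≤ K / nu n := by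
      rw [abs_mul, abs_of_nonneg hξm.1]
      exact (mul_le_of_le_one_right (abs_nonneg _) hξm.2).trans h3
    have heq : η n = (θ n (1 - L.ξ) - (ρ n * (1 - L.ξ) + L.prim L.ξ / (2 * ρ n)))
        + (ρ n - nu n) * (1 - L.ξ) + L.prim L.ξ / (2 * ρ n) := by
      simp only [hηdef]; ring
    rw [heq]
    refine (abs_add_three _ _ _).trans ?_
    rw [add_div, add_div]
    linarith
  have hE : Tendsto (fun n => Real.exp (a n (1 - L.ξ) - a n 1)) atTop (𝓝 1) := by
    have h1 := (hamp _ hξm).sub (hamp 1 h1m)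
    rw [sub_zero] at h1
    simpa [Function.comp_def] using (Real.continuous_exp.tendsto 0).comp h1
  have hcosδ : Tendsto (fun n => Real.cos (δ n) - 1) atTop (𝓝 0) := by
    simpa using ((Real.continuous_cos.tendsto 0).comp hδ).sub_const 1
  have hcosη : Tendsto (fun n => Real.cos (η n)) atTop (𝓝 1) := by
    simpa [Function.comp_def] using (Real.continuous_cos.tendsto 0).comp hη
  have hsinη : Tendsto (fun n => Real.sin (η n)) atTop (𝓝 0) := by
    simpa [Function.comp_def] using (Real.continuous_sin.tendsto 0).comp hη
  -- Since cos(ν + δ) = -(-1)ⁿ sin δ and sin(ν(1 - ξ)) = (-1)ⁿ cos(νξ), multiplying the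
  -- characteristic equation by -(-1)ⁿ expresses ρ sin δ through -h cos δ and a γ term tending to γ
  -- cos(νξ) up to o(1).
  have hmain : Tendsto (fun n => ρ n * Real.sin (δ n) - L.coefA n) atTop (𝓝 0) := by
    have e1 : Tendsto (fun n => Real.cos (nu n * L.ξ) *
        (Real.exp (a n (1 - L.ξ) - a n 1) * Real.cos (η n) - 1)) atTop (𝓝 0) := by
      refine bdd_le_mul_tendsto_zero' 1 (Eventually.of_forall fun n => Real.abs_cos_le_one _) ?_
      simpa using (hE.mul hcosη).sub_const 1
    have e2 : Tendsto (fun n => ((-1) ^ n * Real.cos (nu n * (1 - L.ξ))) *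
        (Real.exp (a n (1 - L.ξ) - a n 1) * Real.sin (η n))) atTop (𝓝 0) := by
      refine bdd_le_mul_tendsto_zero' 1 (Eventually.of_forall fun n => ?_) ?_
      · rw [abs_mul, abs_pow, abs_neg, abs_one, one_pow, one_mul]
        exact Real.abs_cos_le_one _
      · simpa using hE.mul hsinη
    have e3 := ((hcosδ.const_mul (-L.h)).add ((e1.add e2).const_mul L.γ))
    simp only [mul_zero, add_zero] at e3
    refine e3.congr' (h.mono fun n hn => ?_)
    have hc := hn.charEq hL
    have hθ1 : θ n 1 = nu n + δ n := by simp only [hδdef]; ring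
    have hθξ : θ n (1 - L.ξ) = nu n * (1 - L.ξ) + η n := by simp only [hηdef]; ring
    have hs : Real.sin (nu n * (1 - L.ξ)) = (-1) ^ n * Real.cos (nu n * L.ξ) := by
      rw [mul_one_sub, Real.sin_sub, sin_nu, cos_nu]; ring
    have hee : ((-1 : ℝ) ^ n) ^ 2 = 1 := by rw [← pow_mul, mul_comm, pow_mul]; simp
    rw [hθ1, hθξ, Real.cos_add, Real.sin_add, Real.sin_add, hs, cos_nu, sin_nu] at hc
    simp only [coefA]
    set e := (-1 : ℝ) ^ n
    linear_combination e * hc + (ρ n * Real.sin (δ n) + L.h * Real.cos (δ n)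
      - L.γ * Real.exp (a n (1 - L.ξ) - a n 1) * Real.cos (nu n * L.ξ) * Real.cos (η n)) * hee
  have hρν : ∀ᶠ n in atTop, ρ n ≤ 2 * nu n := by
    filter_upwards [h, hν1, (tendsto_const_div_nu K).eventually_le_const one_pos] with n hn hν hK1
    have := (abs_le.1 hn.abs_sub_le).2
    linarith
  -- The product ρδ is bounded and sin δ = δ sinc δ, so sin δ may be replaced by δ.
  have hsin : Tendsto (fun n => ρ n * (δ n - Real.sin (δ n))) atTop (𝓝 0) := by
    have h1 : Tendsto (fun n => 1 - Real.sinc (δ n)) atTop (𝓝 0) := by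
      simpa using ((Real.continuous_sinc.tendsto 0).comp hδ).const_sub 1
    have h2 : Tendsto (fun n => (ρ n * δ n) * (1 - Real.sinc (δ n))) atTop (𝓝 0) := by
      refine bdd_le_mul_tendsto_zero' (4 * K) ?_ h1
      filter_upwards [h, hρν, hδb] with n hn h3 h4
      have h5 := nu_pos n
      have h6 := hn.one_le
      rw [abs_mul, abs_of_pos (by linarith)]
      calc ρ n * |δ n| ≤ 2 * nu n * (2 * K / nu n) := by gcongr
        _ = 4 * K := by field_simp; ring
    refine h2.congr fun n => ?_
    by_cases h0 : δ n = 0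
    · simp [h0]
    · rw [Real.sinc_of_ne_zero h0]; field_simp
  have hrest : Tendsto (fun n => ρ n * (θ n 1 - ρ n)) atTop (𝓝 0) := by
    refine tendsto_zero_of_abs_le_div_nu (2 * K) ?_
    filter_upwards [h, hρν, hθρ] with n hn h3 h4
    have h5 := nu_pos n
    have h6 := hn.one_le
    rw [abs_mul, abs_of_pos (by linarith)]
    calc ρ n * |θ n 1 - ρ n| ≤ 2 * nu n * (K / nu n ^ 2) := by gcongr
      _ = 2 * K / nu n := by field_simp
  -- Uses ν(ρ - ν) = ρδ - ρ(θ(1) - ρ) - (ρ - ν)².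
  have hfin := ((hmain.add hsin).sub hrest).sub (hdρ.pow 2)
  norm_num at hfin
  refine hfin.congr fun n => ?_
  simp only [hδdef]
  ring

/-- Asymptotics of the nodal points, uniform over the nodal points of one eigenvalue. -/
theorem exists_node_asymptotics {lam : ℕ → ℂ} (hL : L.Admissible) (hlam : L.IsEigenvalueSeq lam) :
    ∃ e : ℕ → ℝ, Tendsto e atTop (𝓝 0) ∧ ∀ᶠ n in atTop, ∀ t ∈ L.nodes (lam n),
      |nu n ^ 2 * (t - ((L.nodeIndex (lam n) t : ℝ) + 1 / 2) / ((n : ℝ) + 1 / 2)) -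
        (L.coefA n * (1 - t) + L.prim t / 2)| ≤ e n := by
  obtain ⟨K, hK, hev⟩ := hlam.eventually_angleData hL
  obtain ⟨p, hp⟩ := hev.choice
  have hlim := tendsto_nu_mul_sub hK hL hp
  obtain ⟨B, hB⟩ := isCompact_Icc.exists_bound_of_continuousOn
    (f := L.prim) fun x hx => (hasDerivWithinAt_prim hL.continuousOn hx).continuousWithinAt
  have hB0 : 0 ≤ B := (norm_nonneg _).trans (hB 0 (left_mem_Icc.2 zero_le_one))
  refine ⟨fun n => |nu n * ((p n).1 - nu n) - L.coefA n| + K * B / nu n + K / nu n, ?_, ?_⟩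
  · have := (hlim.abs.add (tendsto_const_div_nu (K * B))).add (tendsto_const_div_nu K)
    simpa using this
  · filter_upwards [hp, tendsto_nu.eventually_ge_atTop 1] with n hn hν t ht
    obtain ⟨k, hk, hθ⟩ := hn.exists_mul_pi hL.continuousOn ht
    rw [hn.nodeIndex_eq hL.continuousOn ht hθ]
    rw [Finset.mem_Ioc] at hk
    have htI := Ioo_subset_Icc_self ((hn.mem_nodes hL.continuousOn).1 ht).1
    have hr := hn.abs_angle_le _ (one_sub_mem_Icc htI)
    rw [hθ, sub_sub_cancel] at hr
    set ρ := (p n).1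
    set r := k * Real.pi - (ρ * (1 - t) + L.prim t / (2 * ρ)) with hrdef
    have hρ1 : 1 ≤ ρ := hn.one_le
    have hρ0 : ρ ≠ 0 := by linarith
    have hν0 := nu_pos n
    have heq : nu n ^ 2 * (t - (((n - k : ℕ) : ℝ) + 1 / 2) / ((n : ℝ) + 1 / 2)) -
        (L.coefA n * (1 - t) + L.prim t / 2) =
        (nu n * (ρ - nu n) - L.coefA n) * (1 - t) - (ρ - nu n) * (L.prim t / (2 * ρ))
          + nu n * r := by
      -- With j = n - k one has (j + 1/2)/(n + 1/2) = 1 - kπ/ν, so the scaled displacement is the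
      -- phase condition multiplied by ν.
      have h1 : nu n ^ 2 * (t - (((n - k : ℕ) : ℝ) + 1 / 2) / ((n : ℝ) + 1 / 2)) =
          nu n * (k * Real.pi - nu n * (1 - t)) := by
        rw [Nat.cast_sub hk.2, nu]
        field_simp
        ring
      have h2 : L.prim t / 2 = ρ * (L.prim t / (2 * ρ)) := by field_simp
      have h3 : k * Real.pi = r + (ρ * (1 - t) + L.prim t / (2 * ρ)) := by rw [hrdef]; ring
      rw [h1, h2, h3]; ring
    rw [heq]
    have e1 : |(nu n * (ρ - nu n) - L.coefA n) * (1 - t)| ≤ |nu n * (ρ - nu n) - L.coefA n| := by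
      rw [abs_mul, abs_of_nonneg (one_sub_mem_Icc htI).1]
      exact mul_le_of_le_one_right (abs_nonneg _) (one_sub_mem_Icc htI).2
    have e2 : |(ρ - nu n) * (L.prim t / (2 * ρ))| ≤ K * B / nu n := by
      have h1 : |L.prim t / (2 * ρ)| ≤ B := by
        rw [abs_div, abs_of_pos (by linarith : 0 < 2 * ρ)]
        exact (div_le_self (abs_nonneg _) (by linarith)).trans (hB t htI)
      rw [abs_mul, mul_div_right_comm]
      exact mul_le_mul hn.abs_sub_le h1 (abs_nonneg _) (by positivity)
    have e3 : |nu n * r| ≤ K / nu n := by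
      rw [abs_mul, abs_of_pos hν0]
      calc nu n * |r| ≤ nu n * (K / nu n ^ 2) := by gcongr
        _ = K / nu n := by field_simp
    calc _ ≤ |(nu n * (ρ - nu n) - L.coefA n) * (1 - t)| +
          |(ρ - nu n) * (L.prim t / (2 * ρ))| + |nu n * r| := by
            refine (abs_add_le _ _).trans ?_
            gcongr
            exact abs_sub _ _
      _ ≤ _ := by linarith

/-- The nodal points are dense. -/
theorem isDenseNodalSubset_nodes {lam : ℕ → ℂ} (hL : L.Admissible)
    (hlam : L.IsEigenvalueSeq lam) : L.IsDenseNodalSubset lam (fun n => L.nodes (lam n)) := by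
  refine ⟨fun n => Subset.rfl, fun x hx => ?_⟩
  obtain ⟨K, hK, hev⟩ := hlam.eventually_angleData hL
  obtain ⟨B, hB⟩ := isCompact_Icc.exists_bound_of_continuousOn
    (f := L.prim) fun x hx => (hasDerivWithinAt_prim hL.continuousOn hx).continuousWithinAt
  have hB0 : 0 ≤ B := (norm_nonneg _).trans (hB 0 (left_mem_Icc.2 zero_le_one))
  have hpi := Real.pi_pos
  have hpi4 := Real.pi_le_four
  -- Large enough to give θ(1 - x) ≥ 4 ≥ π, so that at least one level kπ with k ≥ 1 lies below.
  have hlarge := (tendsto_nu.atTop_mul_const (by linarith [hx.2] : 0 < 1 - x)).eventually_ge_atTop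
    (2 * (B + K + 4))
  have hex : ∀ᶠ n in atTop, ∃ t, t ∈ L.nodes (lam n) ∧ |t - x| ≤ 4 * (B + K + 2) / nu n := by
    filter_upwards [hev, tendsto_nu.eventually_ge_atTop 1, hlarge] with n ⟨p, hn⟩ hν hl
    set ρ := p.1
    set θ := p.2.2
    have hρ1 : 1 ≤ ρ := hn.one_le
    have hνρ : nu n ≤ 2 * ρ := hn.nu_le
    have hθ : ∀ s ∈ Icc (0 : ℝ) 1, |θ s - ρ * s| ≤ B + K := by
      intro s hs
      have h1 := hn.abs_angle_le s hs
      have h2 : |L.prim (1 - s) / (2 * ρ)| ≤ B := by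
        rw [abs_div, abs_of_pos (by linarith : 0 < 2 * ρ)]
        exact (div_le_self (abs_nonneg _) (by linarith)).trans (hB _ (one_sub_mem_Icc hs))
      have h3 : K / nu n ^ 2 ≤ K := div_le_self hK.le (one_le_pow₀ hν)
      calc |θ s - ρ * s| = |(θ s - (ρ * s + L.prim (1 - s) / (2 * ρ)))
            + L.prim (1 - s) / (2 * ρ)| := by ring_nf
        _ ≤ _ := (abs_add_le _ _).trans (by linarith)
    have hs0 : 1 - x ∈ Ioo (0 : ℝ) 1 := ⟨by linarith [hx.2], by linarith [hx.1]⟩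
    have h1 := abs_le.1 (hθ _ (Ioo_subset_Icc_self hs0))
    have h2 : Real.pi ≤ θ (1 - x) := by
      have : nu n * (1 - x) ≤ 2 * ρ * (1 - x) := by
        have := hs0.1
        gcongr
      linarith
    -- The last level reached before s = 1 - x; it gives a node at or to the right of x, at distance
    -- O(1/ν).
    set k := ⌊θ (1 - x) / Real.pi⌋₊ with hk
    have hk1 : (k : ℝ) * Real.pi ≤ θ (1 - x) := by
      rw [← le_div_iff₀ hpi]
      exact Nat.floor_le (div_nonneg (by linarith) hpi.le)
    have hk2 : θ (1 - x) < (k + 1) * Real.pi := by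
      rw [← div_lt_iff₀ hpi]
      exact Nat.lt_floor_add_one _
    have hk0 : (0 : ℝ) < k * Real.pi := by
      have : 0 < k := Nat.floor_pos.2 ((one_le_div hpi).2 h2)
      positivity
    have hcont : ContinuousOn θ (Icc 0 (1 - x)) :=
      hn.prufer.continuousOn_angle.mono (Icc_subset_Icc_right hs0.2.le)
    obtain ⟨s, hs, hsθ⟩ := intermediate_value_Icc hs0.1.le hcont
      (show (k : ℝ) * Real.pi ∈ Icc (θ 0) (θ (1 - x)) from
        ⟨by rw [show θ 0 = 0 from hn.prufer.angle_zero]; exact hk0.le, hk1⟩)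
    have hs1 : s ∈ Icc (0 : ℝ) 1 := ⟨hs.1, hs.2.trans hs0.2.le⟩
    have hspos : 0 < s := by
      refine lt_of_le_of_ne hs.1 fun h0 => ?_
      rw [← h0, show θ 0 = 0 from hn.prufer.angle_zero] at hsθ
      linarith
    refine ⟨1 - s, (hn.mem_nodes hL.continuousOn).2 ⟨⟨by linarith [hs.2, hs0.2], by linarith⟩, ?_⟩, ?_⟩
    · rw [sub_sub_cancel]
      rw [hsθ]
      exact Real.sin_nat_mul_pi k
    · have h3 := abs_le.1 (hθ s hs1)
      have h4 : 1 - s - x = (1 - x) - s := by ring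
      rw [h4, abs_of_nonneg (by linarith [hs.2]), le_div_iff₀ (nu_pos n)]
      have h5 : ρ * ((1 - x) - s) ≤ 2 * (B + K + 2) := by linarith
      have h6 : ((1 - x) - s) * nu n ≤ ((1 - x) - s) * (2 * ρ) := by
        have := hs.2
        gcongr
      linarith
  obtain ⟨t, ht⟩ := hex.choice
  refine ⟨t, ht.mono fun n hn => hn.1, ?_⟩
  have := tendsto_zero_of_abs_le_div_nu (f := fun n => t n - x) _ (ht.mono fun n hn => hn.2)
  simpa using this.add_const x

/-! ### Periodicity of the leading coefficient and uniqueness -/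

/-- Rationality of ξ enters here: raising the index by 2rm adds mp full turns to the argument of the
cosine. The fraction need not be in lowest terms. -/
theorem coefA_add_mul {p : ℤ} {r : ℕ} (hr : 0 < r) (hξ : L.ξ = (p : ℚ) / (r : ℚ)) (i m : ℕ) :
    L.coefA (2 * r * m + i) = L.coefA i := by
  have hξ' : (L.ξ : ℝ) = p / r := by rw [hξ]; push_cast; rfl
  have hr' : (r : ℝ) ≠ 0 := by exact_mod_cast hr.ne'
  have : nu (2 * r * m + i) * L.ξ = nu i * L.ξ + ((m * p : ℤ) : ℝ) * (2 * Real.pi) := by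
    rw [hξ', nu, nu]
    push_cast
    field_simp
    ring
  rw [coefA, this, Real.cos_add_int_mul_two_pi, coefA]

theorem abs_coefA_le (n : ℕ) : |L.coefA n| ≤ |L.γ| + |L.h| := by
  refine (abs_sub _ _).trans (add_le_add_left ?_ _)
  rw [abs_mul]
  exact mul_le_of_le_one_right (abs_nonneg _) (Real.abs_cos_le_one _)

theorem continuousOn_prim (hL : L.Admissible) : ContinuousOn L.prim (Icc 0 1) :=
  fun _ hx => (hasDerivWithinAt_prim hL.continuousOn hx).continuousWithinAt

/-- The difference of the leading coefficients of two problems with common nodal points. -/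
theorem tendsto_coef_sub {L' : NonlocalBVP} (hL : L.Admissible) (hL' : L'.Admissible)
    {lam lam' : ℕ → ℂ} (hlam : L.IsEigenvalueSeq lam) (hlam' : L'.IsEigenvalueSeq lam')
    {t : ℕ → ℝ} (ht : ∀ᶠ n in atTop, t n ∈ L.nodes (lam n))
    (ht' : ∀ᶠ n in atTop, t n ∈ L'.nodes (lam' n)) {x : ℝ} (hx : x ∈ Ioo (0 : ℝ) 1)
    (htx : Tendsto t atTop (𝓝 x)) :
    Tendsto (fun n => (L.coefA n - L'.coefA n) * (1 - x) + (L.prim x - L'.prim x) / 2) atTop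
      (𝓝 0) := by
  obtain ⟨e, he, hev⟩ := exists_node_asymptotics hL hlam
  obtain ⟨e', he', hev'⟩ := exists_node_asymptotics hL' hlam'
  obtain ⟨B, hB⟩ := isCompact_Icc.exists_bound_of_continuousOn (continuousOn_prim hL)
  obtain ⟨B', hB'⟩ := isCompact_Icc.exists_bound_of_continuousOn (continuousOn_prim hL')
  have hpi := Real.pi_gt_three
  set C := |L.γ| + |L.h| + B + 1 + (|L'.γ| + |L'.h| + B' + 1) with hC
  have hbound : ∀ᶠ n in atTop, |(L.coefA n - L'.coefA n) * (1 - t n) +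
      (L.prim (t n) - L'.prim (t n)) / 2| ≤ e n + e' n := by
    filter_upwards [hev, hev', ht, ht', he.eventually_le_const one_pos,
      he'.eventually_le_const one_pos, tendsto_nu.eventually_ge_atTop C] with
      n h1 h2 hn hn' h3 h4 hν
    have g1 := h1 _ hn
    have g2 := h2 _ hn'
    have htI : t n ∈ Icc (0 : ℝ) 1 := Ioo_subset_Icc_self hn.1
    have hs := one_sub_mem_Icc htI
    have hF : ∀ (M : NonlocalBVP) (b : ℝ), |M.prim (t n)| ≤ b →
        |M.coefA n * (1 - t n) + M.prim (t n) / 2| ≤ |M.γ| + |M.h| + b := by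
      intro M b hb
      refine (abs_add_le _ _).trans ?_
      rw [abs_mul, abs_of_nonneg hs.1, abs_div, abs_two]
      have h5 := mul_le_of_le_one_right (abs_nonneg (M.coefA n)) hs.2
      have h6 := M.abs_coefA_le n
      have h7 := abs_nonneg (M.prim (t n))
      linarith
    have f1 := hF L B (hB _ htI)
    have f2 := hF L' B' (hB' _ htI)
    have hν0 := nu_pos n
    -- The same point could a priori carry different indices in the two problems. A discrepancy of
    -- at least 1 would separate the two scaled displacements by at least νπ, while both are
    -- bounded.
    have hj : (L.nodeIndex (lam n) (t n) : ℝ) = L'.nodeIndex (lam' n) (t n) := by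
      set j := L.nodeIndex (lam n) (t n)
      set j' := L'.nodeIndex (lam' n) (t n)
      set D := nu n ^ 2 * (t n - ((j : ℝ) + 1 / 2) / ((n : ℝ) + 1 / 2)) with hD
      set D' := nu n ^ 2 * (t n - ((j' : ℝ) + 1 / 2) / ((n : ℝ) + 1 / 2)) with hD'
      have hDD : D' - D = nu n * Real.pi * ((j : ℝ) - j') := by
        rw [hD, hD', nu]
        field_simp
        ring
      have hd1 : |D| ≤ |L.γ| + |L.h| + B + 1 := by
        have := abs_sub_abs_le_abs_sub D (L.coefA n * (1 - t n) + L.prim (t n) / 2)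
        linarith
      have hd2 : |D'| ≤ |L'.γ| + |L'.h| + B' + 1 := by
        have := abs_sub_abs_le_abs_sub D' (L'.coefA n * (1 - t n) + L'.prim (t n) / 2)
        linarith
      have hd3 : |D' - D| ≤ C := (abs_sub _ _).trans (by linarith)
      rw [hDD, abs_mul, abs_of_pos (by positivity)] at hd3
      have hlt : |(j : ℝ) - j'| < 1 := by
        by_contra hcon
        push Not at hcon
        have : nu n * Real.pi * 1 ≤ nu n * Real.pi * |(j : ℝ) - j'| := by gcongr
        nlinarith
      have hz : |(j : ℤ) - j'| < 1 := by exact_mod_cast hlt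
      have : (j : ℤ) = j' := by rwa [Int.abs_lt_one_iff, sub_eq_zero] at hz
      exact_mod_cast this
    rw [hj] at g1
    rw [abs_le] at g1 g2 ⊢
    constructor <;> linarith [g1.1, g1.2, g2.1, g2.2]
  have hmem : ∀ᶠ n in atTop, t n ∈ Icc (0 : ℝ) 1 := ht.mono fun n hn => Ioo_subset_Icc_self hn.1
  have htw : Tendsto t atTop (𝓝[Icc 0 1] x) := tendsto_nhdsWithin_iff.2 ⟨htx, hmem⟩
  have hxI := Ioo_subset_Icc_self hx
  have h1 : Tendsto (fun n => (L.coefA n - L'.coefA n) * (1 - t n) +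
      (L.prim (t n) - L'.prim (t n)) / 2) atTop (𝓝 0) :=
    squeeze_zero_norm' hbound (by simpa using he.add he')
  -- The coefficients need not converge, but they are bounded, which suffices for replacing t n by
  -- x.
  have h2 : Tendsto (fun n => (L.coefA n - L'.coefA n) * (t n - x)) atTop (𝓝 0) := by
    refine bdd_le_mul_tendsto_zero' (|L.γ| + |L.h| + (|L'.γ| + |L'.h|))
      (Eventually.of_forall fun n => ?_) (by simpa using htx.sub_const x)
    exact (abs_sub _ _).trans (add_le_add (abs_coefA_le n) (abs_coefA_le n))
  have h3 : Tendsto (fun n => (L.prim x - L'.prim x) / 2 - (L.prim (t n) - L'.prim (t n)) / 2) atTop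
      (𝓝 0) := by
    have := ((((continuousOn_prim hL x hxI).tendsto.comp htw).sub
      ((continuousOn_prim hL' x hxI).tendsto.comp htw)).div_const 2).const_sub
        ((L.prim x - L'.prim x) / 2)
    simpa using this
  have h4 := (h1.add h2).add h3
  norm_num at h4
  refine h4.congr fun n => ?_
  ring

/-- The difference equals 2 sin(πξ) sin(πξ/2), with both factors positive for 0 < ξ < 1. It is what
separates γ from h. -/
theorem cos_nu_zero_mul_ne (hL : L.Admissible) :
    Real.cos (nu 0 * L.ξ) - Real.cos (nu 1 * L.ξ) ≠ 0 := by
  have hξ := hL.ξ_mem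
  have hpi := Real.pi_pos
  have e1 : (nu 0 * L.ξ + nu 1 * L.ξ) / 2 = Real.pi * L.ξ := by unfold nu; push_cast; ring
  have e2 : (nu 0 * L.ξ - nu 1 * L.ξ) / 2 = -(Real.pi * L.ξ / 2) := by unfold nu; push_cast; ring
  rw [Real.cos_sub_cos, e1, e2, Real.sin_neg]
  have h0 : 0 < Real.pi * L.ξ := mul_pos hpi hξ.1
  have h1 : Real.pi * L.ξ < Real.pi := mul_lt_of_lt_one_right hpi hξ.2
  have s1 := Real.sin_pos_of_pos_of_lt_pi h0 h1
  have s2 := Real.sin_pos_of_pos_of_lt_pi (x := Real.pi * L.ξ / 2) (by linarith) (by linarith)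
  have := mul_pos s1 s2
  intro h
  linarith

theorem eq_of_common_nodes {L' : NonlocalBVP} (hL : L.Admissible) (hL' : L'.Admissible)
    (hξ : L'.ξ = L.ξ) {lam lam' : ℕ → ℂ} (hlam : L.IsEigenvalueSeq lam)
    (hlam' : L'.IsEigenvalueSeq lam') {X₀ : ℕ → Set ℝ} (hX : L.IsDenseNodalSubset lam X₀)
    (hX' : L'.IsDenseNodalSubset lam' X₀) :
    (∀ x ∈ Ioo (0 : ℝ) 1, L.q x = L'.q x) ∧ L.h = L'.h ∧ L.γ = L'.γ := by
  -- Along indices congruent to i modulo twice the denominator of ξ the expression in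
  -- `tendsto_coef_sub` is constant, so its limit 0 is its value.
  have hkey : ∀ x ∈ Ioo (0 : ℝ) 1, ∀ i,
      (L.coefA i - L'.coefA i) * (1 - x) + (L.prim x - L'.prim x) / 2 = 0 := by
    intro x hx i
    obtain ⟨t, ht, htx⟩ := hX.2 x hx
    have hlim := tendsto_coef_sub hL hL' hlam hlam' (ht.mono fun n hn => hX.1 n hn)
      (ht.mono fun n hn => hX'.1 n hn) hx htx
    have hden := L.ξ.den_pos
    have hsub : Tendsto (fun m => 2 * L.ξ.den * m + i) atTop atTop :=
      tendsto_atTop_mono (fun m => by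
      have : 1 * m ≤ 2 * L.ξ.den * m := Nat.mul_le_mul_right m (by omega)
      simp only [id]
      omega) tendsto_id
    have h1 := hlim.comp hsub
    have hL1 := fun m => coefA_add_mul (L := L) (p := L.ξ.num) hden (Rat.num_div_den _).symm i m
    have hL2 := fun m => coefA_add_mul (L := L') (p := L.ξ.num) hden
      (by rw [hξ]; exact (Rat.num_div_den _).symm) i m
    simp only [Function.comp_def, hL1, hL2] at h1
    exact tendsto_nhds_unique tendsto_const_nhds h1
  have hγ : L.γ = L'.γ := by
    have h0 := hkey (1 / 2) ⟨by norm_num, by norm_num⟩ 0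
    have h1 := hkey (1 / 2) ⟨by norm_num, by norm_num⟩ 1
    simp only [coefA, hξ] at h0 h1
    -- Subtracting the identities for i = 0 and i = 1 eliminates h and the primitives.
    have h2 : (L.γ - L'.γ) * (Real.cos (nu 0 * L.ξ) - Real.cos (nu 1 * L.ξ)) = 0 := by
      linear_combination 2 * h0 - 2 * h1
    exact sub_eq_zero.1 ((mul_eq_zero.1 h2).resolve_right (cos_nu_zero_mul_ne hL))
  set g : ℝ → ℝ := fun x => (L'.h - L.h) * (1 - x) + (L.prim x - L'.prim x) / 2 with hg
  have hg0 : ∀ x ∈ Ioo (0 : ℝ) 1, g x = 0 := by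
    intro x hx
    have := hkey x hx 0
    simp only [coefA, hξ, hγ] at this
    simp only [hg]
    linear_combination this
  have hgd : ∀ x ∈ Icc (0 : ℝ) 1,
      HasDerivWithinAt g (-(L'.h - L.h) + (L.q x - L'.q x) / 2) (Icc 0 1) x := by
    intro x hx
    have h1 := (((hasDerivWithinAt_id x (Icc (0 : ℝ) 1)).const_sub 1).const_mul (L'.h - L.h)).add
      (((hasDerivWithinAt_prim hL.continuousOn hx).sub
        (hasDerivWithinAt_prim hL'.continuousOn hx)).div_const 2)
    refine h1.congr_deriv ?_
    ring
  -- The primitives vanish at 0, so g(0) is the difference of the h's; it is zero by continuity from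
  -- the right.
  have hh : L.h = L'.h := by
    have h0m : (0 : ℝ) ∈ Icc (0 : ℝ) 1 := left_mem_Icc.2 zero_le_one
    have h1 : Tendsto g (𝓝[Ioo 0 1] 0) (𝓝 (g 0)) :=
      ((hgd 0 h0m).continuousWithinAt.mono Ioo_subset_Icc_self).tendsto
    have h2 : Tendsto g (𝓝[Ioo 0 1] 0) (𝓝 0) :=
      tendsto_const_nhds.congr' (eventually_mem_nhdsWithin.mono fun x hx => (hg0 x hx).symm)
    have : (𝓝[Ioo (0 : ℝ) 1] 0).NeBot := by
      rw [nhdsWithin_Ioo_eq_nhdsGT one_pos]; infer_instance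
    have h3 := tendsto_nhds_unique h1 h2
    simp [hg, prim] at h3
    linarith
  refine ⟨fun x hx => ?_, hh, hγ⟩
  have h1 := (hgd x (Ioo_subset_Icc_self hx)).hasDerivAt (Icc_mem_nhds hx.1 hx.2)
  have h2 : HasDerivAt g 0 x := (hasDerivAt_const x (0 : ℝ)).congr_of_eventuallyEq
    (by filter_upwards [Ioo_mem_nhds hx.1 hx.2] with y hy using hg0 y hy)
  have h3 := h1.unique h2
  rw [hh] at h3
  linarith

/-! ### Reconstruction -/

/-- The function recovered from the nodal points. -/
noncomputable def nodalLimit (L : NonlocalBVP) (x : ℝ) : ℝ := L.coefA 0 * (1 - x) + L.prim x / 2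

theorem hasDerivWithinAt_nodalLimit (hL : L.Admissible) {x : ℝ} (hx : x ∈ Icc (0 : ℝ) 1) :
    HasDerivWithinAt L.nodalLimit (-L.coefA 0 + L.q x / 2) (Icc 0 1) x := by
  have h1 := (((hasDerivWithinAt_id x (Icc (0 : ℝ) 1)).const_sub 1).const_mul (L.coefA 0)).add
    ((hasDerivWithinAt_prim hL.continuousOn hx).div_const 2)
  refine h1.congr_deriv ?_
  ring

theorem nodalLimit_zero : L.nodalLimit 0 = L.coefA 0 := by simp [nodalLimit, prim]

/-- The indices 2rn all lie in the residue class of 0, where the leading coefficient is constantly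
`L.coefA 0`. Uniformity of the node asymptotics allows x to be an end point and the nodes to be
chosen arbitrarily. -/
theorem tendsto_nodalLimit (hL : L.Admissible) {lam : ℕ → ℂ} (hlam : L.IsEigenvalueSeq lam)
    {p : ℤ} {r : ℕ} (hr : 0 < r) (hξ : L.ξ = (p : ℚ) / (r : ℚ)) {x : ℝ}
    (hx : x ∈ Icc (0 : ℝ) 1) {t : ℕ → ℝ}
    (ht : ∀ᶠ n in atTop, t n ∈ L.nodes (lam (2 * r * n))) (htx : Tendsto t atTop (𝓝 x)) :
    Tendsto (fun n : ℕ => (((2 * r * n : ℕ) : ℝ) + 1 / 2) ^ 2 * Real.pi ^ 2 *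
      (t n - ((L.nodeIndex (lam (2 * r * n)) (t n) : ℝ) + 1 / 2) /
        (((2 * r * n : ℕ) : ℝ) + 1 / 2))) atTop (𝓝 (L.nodalLimit x)) := by
  obtain ⟨e, he, hev⟩ := exists_node_asymptotics hL hlam
  have hsub : Tendsto (fun m => 2 * r * m) atTop atTop :=
    tendsto_atTop_mono (fun m => by
      have : 1 * m ≤ 2 * r * m := Nat.mul_le_mul_right m (by omega)
      simp only [id]
      omega) tendsto_id
  have hmem : ∀ᶠ n in atTop, t n ∈ Icc (0 : ℝ) 1 := ht.mono fun n hn => Ioo_subset_Icc_self hn.1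
  have h1 : Tendsto (fun n => L.nodalLimit (t n)) atTop (𝓝 (L.nodalLimit x)) :=
    (hasDerivWithinAt_nodalLimit hL hx).continuousWithinAt.tendsto.comp
      (tendsto_nhdsWithin_iff.2 ⟨htx, hmem⟩)
  have h2 : Tendsto (fun n : ℕ => (((2 * r * n : ℕ) : ℝ) + 1 / 2) ^ 2 * Real.pi ^ 2 *
      (t n - ((L.nodeIndex (lam (2 * r * n)) (t n) : ℝ) + 1 / 2) /
        (((2 * r * n : ℕ) : ℝ) + 1 / 2)) - L.nodalLimit (t n)) atTop (𝓝 0) := by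
    refine squeeze_zero_norm' ?_ (he.comp hsub)
    filter_upwards [hsub.eventually hev, ht] with n hn htn
    have h3 := hn _ htn
    rw [← add_zero (2 * r * n), coefA_add_mul hr hξ 0 n, add_zero, nu, mul_pow] at h3
    exact h3
  simpa using h2.add h1

end NonlocalBVP

theorem theorem3 (L : NonlocalBVP) (hL : L.Admissible) (lam : ℕ → ℂ)
    (hlam : L.IsEigenvalueSeq lam) :
    -- the family of all nodal points is dense
    L.IsDenseNodalSubset lam (fun n => L.nodes (lam n)) ∧
    -- uniqueness
    (∀ (L' : NonlocalBVP), L'.Admissible → L'.ξ = L.ξ →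
      ∀ lam' : ℕ → ℂ, L'.IsEigenvalueSeq lam' →
      ∀ X₀ X₀' : ℕ → Set ℝ, L.IsDenseNodalSubset lam X₀ → L'.IsDenseNodalSubset lam' X₀' →
        X₀ = X₀' →
        (∀ᵐ x ∂(volume.restrict (Ioo (0 : ℝ) 1)), L.q x = L'.q x) ∧ L.h = L'.h ∧ L.γ = L'.γ) ∧
    -- reconstruction
    (∀ X₀ : ℕ → Set ℝ, L.IsDenseNodalSubset lam X₀ →
      ∀ (p : ℤ) (r : ℕ), 0 < r → L.ξ = (p : ℚ) / (r : ℚ) →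
      ∃ ψ : ℝ → ℝ,
        (∀ x ∈ Icc (0 : ℝ) 1, ∀ t : ℕ → ℝ,
          (∀ᶠ n in atTop, t n ∈ X₀ (2 * r * n)) → Tendsto t atTop (𝓝 x) →
          Tendsto
            (fun n : ℕ =>
              (((2 * r * n : ℕ) : ℝ) + 1 / 2) ^ 2 * Real.pi ^ 2 *
                (t n - ((L.nodeIndex (lam (2 * r * n)) (t n) : ℝ) + 1 / 2) /
                  (((2 * r * n : ℕ) : ℝ) + 1 / 2)))
            atTop (𝓝 (ψ x))) ∧
        DifferentiableOn ℝ ψ (Icc 0 1) ∧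
        (∀ x ∈ Icc (0 : ℝ) 1, L.q x = 2 * (derivWithin ψ (Icc 0 1) x + ψ 0)) ∧
        L.γ * Real.cos (Real.pi / 2 * (L.ξ : ℝ)) - L.h = ψ 0) := by
  refine ⟨NonlocalBVP.isDenseNodalSubset_nodes hL hlam, ?_, ?_⟩
  · rintro L' hL' hξ lam' hlam' X₀ X₀' hX hX' rfl
    obtain ⟨hq, hh, hγ⟩ := NonlocalBVP.eq_of_common_nodes hL hL' hξ hlam hlam' hX hX'
    exact ⟨ae_restrict_of_forall_mem measurableSet_Ioo hq, hh, hγ⟩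
  · intro X₀ hX p r hr hξ
    refine ⟨L.nodalLimit, fun x hx t ht htx => ?_, fun x hx => ?_, fun x hx => ?_, ?_⟩
    · exact NonlocalBVP.tendsto_nodalLimit hL hlam hr hξ hx
        (ht.mono fun n hn => hX.1 _ hn) htx
    · exact (NonlocalBVP.hasDerivWithinAt_nodalLimit hL hx).differentiableWithinAt
    -- With ψ' = -A_0 + q/2 and ψ(0) = A_0 the constant cancels in ψ' + ψ(0).
    · rw [(NonlocalBVP.hasDerivWithinAt_nodalLimit hL hx).derivWithin
        (uniqueDiffOn_Icc_zero_one x hx), NonlocalBVP.nodalLimit_zero]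
      ring
    · rw [NonlocalBVP.nodalLimit_zero, NonlocalBVP.coefA, NonlocalBVP.nu]
      congr 3
      push_cast
      ring
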